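/- Let $n\in\{1,2,\dots,\infty\}$ and let $\mathcal{TO}_n$ be the universal unital $C^*$-algebra generated by $n$ isometries $v_1,v_2,\dots$ with mutually orthogonal ranges (so $\mathcal{TO}_\infty=\mathcal O_\infty$). For a multi-index $\mu=(i_1,\dots,i_k)$ put $|\mu|=k$, $v_\mu=v_{i_1}\cdots v_{i_k}$. Let $F_{\mathcal E}$ be full Fock space over an $n$-dimensional Hilbert space, realised as the Hilbert space with orthonormal basis $(e_\mu)_\mu$ indexed by all multi-indices; let $l(v_i)e_\mu=e_{i\mu}$ and $r(v_i)e_\mu=e_{\mu i}$ be left and right creation, and let $l:\mathcal{TO}_n\to\mathcal B(F_{\mathcal E})$ also denote the resulting Fock representation. For $A\in\mathcal B(F_{\mathcal E})$ put $\beta(A)=\sum_i r(v_i)A\,r(v_i)^*$ (strong sum), $\delta(A)=A-\beta(A)$, and let $P_k=I-\beta^{k+1}(I)$. Let $\mathfrak B_k=\{T: T=P_kTP_k\}$, $\mathfrak B=\bigcup_k\mathfrak B_k$, and $\lambda(B)=\sum_{i\ge0}\beta^i(B)$ for $B\in\mathfrak B$. The map $\delta$ is the inverse of $\lambda$ on $\lambda(\mathfrak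 B)$. A positive linear functional $\omega$ on $\mathfrak B$ is *decreasing* if $\omega\circ\delta$ is positive on $\mathfrak B$, and *locally normal* if $\omega|_{\mathfrak B_k}$ is normal for every $k$. For a decreasing positive $\omega$, $\Delta\omega$ denotes the unique positive linear functional on the $C^*$-algebra $\overline{\lambda(\mathfrak B)}$ (which contains $l(\mathcal{TO}_n)$) that extends $\omega\circ\delta|_{\lambda(\mathfrak B)}$. A positive linear functional on $\mathcal{TO}_n$ with GNS representation $\pi$ is *essential* if $\sum_i\pi(v_iv_i^*)=I$, and *singular* if $\sum_{|\mu|=k}\pi(v_\mu v_\mu^*)\to0$ strongly as $k\to\infty$. The *singular part* of $\rho$ is the singular component in the unique decomposition of $\rho$ as the sum of a singular and an essential positive linear functional. **Theorem.** Let $\rho$ be a positive linear functional on $\mathcal{TO}_n$. There is a unique decreasing locally normal positive linear functional $\omega$ on $\mathfrak B$ such that $\rho=\Delta\omega\circ l$. For this $\omega$, the functional $\omega\circ\delta|_{\mathfrak B}$ extends uniquely to a normal positive linear functional $\phi$ on $\mathcal B(F_{\mathcal E})$. Moreover $\rho$ has a unique decomposition as the sum of a singular and an essential positive linear functional, and its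 singular part is $\phi\circ l$. -/

import Mathlib

open scoped ComplexOrder InnerProductSpace Topology

universe u v

namespace TC

/-! ### Toeplitz--Cuntz algebras -/

/-- A family of isometries with mutually orthogonal ranges in a unital C*-algebra. -/
def IsIsometricFamily {ι : Type*} {B : Type*} [CStarAlgebra B] (w : ι → B) : Prop :=
  (∀ i, star (w i) * w i = 1) ∧ ∀ i j, i ≠ j → star (w i) * w j = 0

/-- `A`, generated as a C*-algebra by the isometries `v i` with mutually orthogonal ranges, is the
universal unital C*-algebra for such families: it is the Toeplitz--Cuntz algebra whose
distinguished generators are the `v i`. (For infinite countable `ι` this is `𝒪_∞`.) -/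
structure IsToeplitzCuntz {ι : Type u} {A : Type v} [CStarAlgebra A] (v : ι → A) : Prop where
  isometricFamily : IsIsometricFamily v
  generates : (StarAlgebra.adjoin ℂ (Set.range v)).topologicalClosure = ⊤
  universal : ∀ (B : Type u) [CStarAlgebra B] (w : ι → B), IsIsometricFamily w →
    ∃ π : A →⋆ₐ[ℂ] B, ∀ i, π (v i) = w i

/-- Index type for the construction of the universal algebra: all families of isometries with
mutually orthogonal ranges in nonzero unital C*-algebras. -/
structure Family (ι : Type u) : Type (u + 1) where
  carrier : Type u
  [cstar : CStarAlgebra carrier]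
  [nontrivial : Nontrivial carrier]
  w : ι → carrier
  isometric : IsIsometricFamily w

attribute [instance] Family.cstar Family.nontrivial

/-- The C*-algebra of bounded sections over all such families. -/
abbrev Sections (ι : Type u) : Type (u + 1) := lp (fun F : Family ι => F.carrier) ⊤

noncomputable instance (ι : Type u) : CStarAlgebra (Sections ι) where
  __ := (inferInstance : NonUnitalCStarAlgebra (Sections ι))
  __ := (lp.inftyNormedRing : NormedRing (Sections ι))
  __ := (lp.inftyNormedAlgebra : NormedAlgebra ℂ (Sections ι))

theorem norm_le_one_of_isometry {B : Type*} [CStarAlgebra B] [Nontrivial B] (w : B)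
    (h : star w * w = 1) : ‖w‖ ≤ 1 := by
  have := CStarRing.norm_star_mul_self (x := w)
  rw [h, norm_one] at this
  nlinarith [norm_nonneg w]

/-- The section whose value at every family is the `i`-th isometry of that family. -/
noncomputable def genSection {ι : Type u} (i : ι) : Sections ι :=
  ⟨fun F => F.w i, memℓp_infty
    ⟨1, by rintro _ ⟨F, rfl⟩; exact norm_le_one_of_isometry _ (F.isometric.1 i)⟩⟩

/-- A concrete Toeplitz--Cuntz algebra: the C*-algebra generated by the sections `genSection i`. -/
noncomputable abbrev ToeplitzCuntz (ι : Type u) : StarSubalgebra ℂ (Sections ι) :=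
  (StarAlgebra.adjoin ℂ (Set.range (genSection (ι := ι)))).topologicalClosure

noncomputable instance (ι : Type u) : CStarAlgebra (ToeplitzCuntz ι) :=
  StarSubalgebra.cstarAlgebra _ (h_closed :=
    (StarAlgebra.adjoin ℂ (Set.range (genSection (ι := ι)))).isClosed_topologicalClosure)

/-- The distinguished generators of `ToeplitzCuntz ι`. -/
noncomputable def toeplitzGen {ι : Type u} (i : ι) : ToeplitzCuntz ι :=
  ⟨genSection i, (StarAlgebra.adjoin ℂ _).le_topologicalClosure
    (StarAlgebra.subset_adjoin _ _ ⟨i, rfl⟩)⟩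

/-- Evaluation of sections at a family. -/
noncomputable def evalSection {ι : Type u} (F : Family ι) : Sections ι →⋆ₐ[ℂ] F.carrier where
  toFun f := f F
  map_one' := rfl
  map_zero' := rfl
  map_mul' _ _ := rfl
  map_add' _ _ := rfl
  commutes' _ := rfl
  map_star' _ := rfl

/-- The universal algebra exists. -/
theorem isToeplitzCuntz_toeplitzGen (ι : Type u) :
    IsToeplitzCuntz (toeplitzGen (ι := ι)) where
  isometricFamily := by
    constructor
    · intro i
      apply Subtype.ext
      apply Subtype.ext
      funext F
      exact F.isometric.1 i
    · intro i j hij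
      apply Subtype.ext
      apply Subtype.ext
      funext F
      exact F.isometric.2 i j hij
  generates := by
    rw [eq_top_iff]
    rintro ⟨x, hx⟩ -
    have h0 : StarAlgebra.adjoin ℂ (Set.range (genSection (ι := ι))) ≤
        (StarAlgebra.adjoin ℂ (Set.range (toeplitzGen (ι := ι)))).map
          (ToeplitzCuntz ι).subtype := by
      rw [StarAlgHom.map_adjoin]
      apply StarAlgebra.adjoin_mono
      rintro _ ⟨i, rfl⟩
      exact ⟨toeplitzGen i, ⟨i, rfl⟩, rfl⟩
    have hx' : x ∈ closure ((StarAlgebra.adjoin ℂ (Set.range (genSection (ι := ι)))) : Set _) := hx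
    rw [← SetLike.mem_coe, StarSubalgebra.topologicalClosure_coe, closure_subtype]
    exact closure_mono h0 hx'
  universal := by
    intro B _ w hw
    cases subsingleton_or_nontrivial B with
    | inl h =>
      exact ⟨⟨⟨⟨⟨⟨fun _ => 0, Subsingleton.elim _ _⟩, fun _ _ => Subsingleton.elim _ _⟩,
        Subsingleton.elim _ _, fun _ _ => Subsingleton.elim _ _⟩, fun _ => Subsingleton.elim _ _⟩,
        fun _ => Subsingleton.elim _ _⟩, fun _ => Subsingleton.elim _ _⟩
    | inr h => exact ⟨(evalSection ⟨B, w, hw⟩).comp (ToeplitzCuntz ι).subtype, fun _ => rfl⟩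

/-- `v_μ = v_{i₁} ⋯ v_{i_k}` for the multi-index `μ = (i₁, …, i_k)`. -/
def word {ι : Type*} {A : Type*} [Monoid A] (v : ι → A) (μ : List ι) : A := (μ.map v).prod

/-! ### Fock space and the creation operators -/

/-- Full Fock space: the Hilbert space with orthonormal basis indexed by the multi-indices. The
basis vector at `μ` is the vector `v_μ`; the `k`-th summand is spanned by those with `|μ| = k`. -/
abbrev Fock (ι : Type u) : Type u := lp (fun _ : List ι => ℂ) 2

/-- The bounded operators on Fock space. -/
abbrev FockOp (ι : Type u) : Type u := Fock ι →L[ℂ] Fock ι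

open Classical in
/-- The basis vector `v_μ` of Fock space. -/
noncomputable def fockBasis {ι : Type u} (μ : List ι) : Fock ι := lp.single 2 μ (1 : ℂ)

theorem fockBasis_orthonormal {ι : Type u} : Orthonormal ℂ (fockBasis (ι := ι)) := by
  classical
  rw [orthonormal_iff_ite]
  intro μ ν
  unfold fockBasis
  rw [lp.inner_single_left]
  by_cases h : μ = ν
  · subst h; simp
  · simp [h]

/-- The isometry of Fock space sending the basis vector at `μ` to the one at `f μ`. -/
noncomputable def shift {ι : Type u} (f : List ι → List ι) (hf : Function.Injective f) :
    Fock ι →ₗᵢ[ℂ] Fock ι :=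
  (fockBasis_orthonormal.comp f hf).orthogonalFamily.linearIsometry

theorem shift_fockBasis {ι : Type u} (f : List ι → List ι) (hf : Function.Injective f)
    (μ : List ι) : shift f hf (fockBasis μ) = fockBasis (f μ) := by
  classical
  unfold shift
  conv_lhs => rw [fockBasis]
  rw [OrthogonalFamily.linearIsometry_apply_single]
  simp

theorem inner_shift_shift {ι : Type u} {f g : List ι → List ι} (hf : Function.Injective f)
    (hg : Function.Injective g) (hfg : ∀ μ ν, f μ ≠ g ν) (x y : Fock ι) :
    ⟪shift f hf x, shift g hg y⟫_ℂ = 0 := by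
  have hx := (fockBasis_orthonormal.comp f hf).orthogonalFamily.hasSum_linearIsometry x
  have hy := (fockBasis_orthonormal.comp g hg).orthogonalFamily.hasSum_linearIsometry y
  have key : ∀ μ, ⟪fockBasis (f μ), shift g hg y⟫_ℂ = 0 := by
    intro μ
    have h1 := hy.mapL (innerSL ℂ (fockBasis (f μ)))
    refine h1.unique ?_
    convert hasSum_zero with ν
    simp [fockBasis_orthonormal.inner_eq_zero (hfg μ ν)]
  have h2 := hx.mapL ((innerSL ℂ (shift g hg y)))
  have h3 : ⟪shift g hg y, shift f hf x⟫_ℂ = 0 := by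
    refine h2.unique ?_
    convert hasSum_zero with μ
    simp [inner_eq_zero_symm.1 (key μ)]
  exact inner_eq_zero_symm.1 h3

/-- Left creation `l(v_i)`: left multiplication by `v_i`, `v_μ ↦ v_i v_μ`. -/
noncomputable def leftCreation {ι : Type u} (i : ι) : Fock ι →ₗᵢ[ℂ] Fock ι :=
  shift (fun μ => i :: μ) (List.cons_injective)

/-- Right creation `r(v_i)`: right multiplication by `v_i`, `v_μ ↦ v_μ v_i`. -/
noncomputable def rightCreation {ι : Type u} (i : ι) : Fock ι →ₗᵢ[ℂ] Fock ι :=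
  shift (fun μ => μ ++ [i]) (List.append_left_injective [i])

theorem leftCreation_isIsometricFamily (ι : Type u) :
    IsIsometricFamily fun i : ι => ((leftCreation i).toContinuousLinearMap : FockOp ι) := by
  refine ⟨fun i => ?_, fun i j hij => ?_⟩
  · ext1 x
    refine ext_inner_left ℂ fun y => ?_
    simp [ContinuousLinearMap.star_eq_adjoint, ContinuousLinearMap.adjoint_inner_right]
  · ext1 x
    refine ext_inner_left ℂ fun y => ?_
    rw [ContinuousLinearMap.star_eq_adjoint, mul_apply_eq_comp,
      ContinuousLinearMap.adjoint_inner_right]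
    have h0 : ⟪leftCreation i y, leftCreation j x⟫_ℂ = 0 :=
      inner_shift_shift List.cons_injective List.cons_injective
        (fun _ _ h => hij (List.cons.inj h).1) y x
    simpa using h0

theorem rightCreation_orthogonalFamily (ι : Type u) :
    OrthogonalFamily ℂ (fun _ : ι => Fock ι) rightCreation := by
  intro i j hij x y
  refine inner_shift_shift _ _ (fun μ ν h => hij ?_) x y
  simpa using (List.append_inj' h rfl).2

/-- The Fock representation `l`, determined by `l (v i) = leftCreation i`. -/
noncomputable def fockRep {ι : Type u} {A : Type v} [CStarAlgebra A] {v : ι → A}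
    (hv : IsToeplitzCuntz v) : A →⋆ₐ[ℂ] FockOp ι :=
  (hv.universal (FockOp ι) _ (leftCreation_isIsometricFamily ι)).choose

theorem fockRep_apply {ι : Type u} {A : Type v} [CStarAlgebra A] {v : ι → A}
    (hv : IsToeplitzCuntz v) (i : ι) :
    fockRep hv (v i) = (leftCreation i).toContinuousLinearMap :=
  (hv.universal (FockOp ι) _ (leftCreation_isIsometricFamily ι)).choose_spec i

/-! ### The endomorphism `β` of the bounded operators on Fock space -/

section endo

variable {ι : Type*} {H : Type*} [NormedAddCommGroup H] [InnerProductSpace ℂ H] [CompleteSpace H]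
  {V : ι → H →ₗᵢ[ℂ] H}

/-- The Hilbert space adjoint of an isometry. -/
noncomputable abbrev adj (U : H →ₗᵢ[ℂ] H) : H →L[ℂ] H :=
  ContinuousLinearMap.adjoint U.toContinuousLinearMap

theorem sum_adjoint_sq_le (hV : OrthogonalFamily ℂ (fun _ : ι => H) V) (x : H) (s : Finset ι) :
    ∑ i ∈ s, ‖adj (V i) x‖ ^ 2 ≤ ‖x‖ ^ 2 := by
  set y : H := ∑ i ∈ s, V i (adj (V i) x) with hy
  have h1 : ‖y‖ ^ 2 = ∑ i ∈ s, ‖adj (V i) x‖ ^ 2 :=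
    hV.norm_sum (fun i => adj (V i) x) s
  have h2 : (⟪y, x⟫_ℂ) = ((‖y‖ ^ 2 : ℝ) : ℂ) := by
    rw [h1, hy, sum_inner]
    push_cast
    refine Finset.sum_congr rfl fun i _ => ?_
    have := ContinuousLinearMap.adjoint_inner_right (V i).toContinuousLinearMap (adj (V i) x) x
    rw [inner_self_eq_norm_sq_to_K (𝕜 := ℂ)] at this
    exact this.symm
  have h3 : ‖y‖ ^ 2 ≤ ‖y‖ * ‖x‖ := by
    have := norm_inner_le_norm (𝕜 := ℂ) y x
    rw [h2, Complex.norm_real, Real.norm_of_nonneg (by positivity)] at this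
    exact this
  rw [← h1]
  have : ‖y‖ ≤ ‖x‖ := by
    by_contra hc
    push Not at hc
    nlinarith [norm_nonneg x, norm_nonneg y]
  gcongr

theorem sum_apply_adjoint_sq_le (hV : OrthogonalFamily ℂ (fun _ : ι => H) V) (T : H →L[ℂ] H)
    (x : H) (s : Finset ι) :
    ∑ i ∈ s, ‖T (adj (V i) x)‖ ^ 2 ≤ (‖T‖ * ‖x‖) ^ 2 := by
  calc _ ≤ ∑ i ∈ s, ‖T‖ ^ 2 * ‖adj (V i) x‖ ^ 2 := by
        gcongr with i _
        rw [← mul_pow]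
        gcongr
        exact T.le_opNorm _
    _ = ‖T‖ ^ 2 * ∑ i ∈ s, ‖adj (V i) x‖ ^ 2 := by rw [Finset.mul_sum]
    _ ≤ ‖T‖ ^ 2 * ‖x‖ ^ 2 := by gcongr; exact sum_adjoint_sq_le hV x s
    _ = _ := by ring

theorem summable_endo (hV : OrthogonalFamily ℂ (fun _ : ι => H) V) (T : H →L[ℂ] H) (x : H) :
    Summable fun i => V i (T (adj (V i) x)) :=
  (hV.summable_iff_norm_sq_summable fun i => T (adj (V i) x)).2
    (summable_of_sum_le (fun _ => by positivity) (sum_apply_adjoint_sq_le hV T x))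

theorem norm_endo_le (hV : OrthogonalFamily ℂ (fun _ : ι => H) V) (T : H →L[ℂ] H) (x : H) :
    ‖∑' i, V i (T (adj (V i) x))‖ ≤ ‖T‖ * ‖x‖ := by
  refine le_of_tendsto (summable_endo hV T x).hasSum.norm (.of_forall fun s => ?_)
  have h := hV.norm_sum (fun i => T (adj (V i) x)) s
  have h2 := sum_apply_adjoint_sq_le hV T x s
  rw [← h] at h2
  exact (sq_le_sq₀ (norm_nonneg _) (by positivity)).1 h2

/-- The operator `∑ᵢ Vᵢ T Vᵢ*`, a strongly convergent sum, for isometries `Vᵢ` with mutually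
orthogonal ranges. -/
noncomputable def endoFun (hV : OrthogonalFamily ℂ (fun _ : ι => H) V) (T : H →L[ℂ] H) :
    H →L[ℂ] H :=
  LinearMap.mkContinuous
    { toFun := fun x => ∑' i, V i (T (adj (V i) x))
      map_add' := fun x y => by
        simp only [map_add]
        exact (summable_endo hV T x).tsum_add (summable_endo hV T y)
      map_smul' := fun c x => by
        simp only [map_smul, RingHom.id_apply]
        exact (summable_endo hV T x).tsum_const_smul c }
    ‖T‖ (norm_endo_le hV T)

theorem hasSum_endoFun (hV : OrthogonalFamily ℂ (fun _ : ι => H) V) (T : H →L[ℂ] H) (x : H) :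
    HasSum (fun i => V i (T (adj (V i) x))) (endoFun hV T x) :=
  (summable_endo hV T x).hasSum

theorem adjoint_endoFun (hV : OrthogonalFamily ℂ (fun _ : ι => H) V) (T : H →L[ℂ] H) (x : H)
    (i : ι) : adj (V i) (endoFun hV T x) =
      T (adj (V i) x) := by
  refine ext_inner_left ℂ fun y => ?_
  rw [ContinuousLinearMap.adjoint_inner_right]
  refine ((hasSum_endoFun hV T x).mapL (innerSL ℂ ((V i).toContinuousLinearMap y))).unique ?_
  convert hasSum_single i ?_ using 1
  · simp
  · intro j hj
    simpa using hV hj.symm y _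

/-- `T ↦ ∑ᵢ Vᵢ T Vᵢ*` as a `*`-endomorphism. -/
noncomputable def endo (hV : OrthogonalFamily ℂ (fun _ : ι => H) V) :
    (H →L[ℂ] H) →⋆ₙₐ[ℂ] (H →L[ℂ] H) where
  toFun := endoFun hV
  map_smul' c T := by
    ext1 x
    refine (hasSum_endoFun hV (c • T) x).unique ?_
    simpa using (hasSum_endoFun hV T x).const_smul c
  map_zero' := by
    ext1 x
    refine (hasSum_endoFun hV 0 x).unique ?_
    simp
  map_add' S T := by
    ext1 x
    refine (hasSum_endoFun hV (S + T) x).unique ?_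
    simpa using (hasSum_endoFun hV S x).add (hasSum_endoFun hV T x)
  map_mul' S T := by
    ext1 x
    refine (hasSum_endoFun hV (S * T) x).unique ?_
    simpa [adjoint_endoFun] using hasSum_endoFun hV S (endoFun hV T x)
  map_star' T := by
    rw [ContinuousLinearMap.star_eq_adjoint, ContinuousLinearMap.star_eq_adjoint,
      ContinuousLinearMap.eq_adjoint_iff]
    intro x y
    have h1 := (hasSum_endoFun hV (ContinuousLinearMap.adjoint T) x).mapL (innerSL ℂ y)
    have h2 := (hasSum_endoFun hV T y).mapL (innerSL ℂ x)
    rw [← inner_conj_symm]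
    refine HasSum.unique ?_ h2
    refine (Complex.hasSum_conj'.2 h1).congr_fun fun i => ?_
    have e1 := ContinuousLinearMap.adjoint_inner_left (V i).toContinuousLinearMap
      (T (adj (V i) y)) x
    have e2 := ContinuousLinearMap.adjoint_inner_right (V i).toContinuousLinearMap y
      (ContinuousLinearMap.adjoint T (adj (V i) x))
    have e3 := ContinuousLinearMap.adjoint_inner_left T (adj (V i) y) (adj (V i) x)
    have e4 := ContinuousLinearMap.adjoint_inner_left (V i).toContinuousLinearMap
      (ContinuousLinearMap.adjoint T (adj (V i) x)) y
    change ⟪x, V i (T (adj (V i) y))⟫_ℂ = (starRingEnd ℂ)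
      ⟪y, V i (ContinuousLinearMap.adjoint T (adj (V i) x))⟫_ℂ
    rw [inner_conj_symm]
    refine e1.symm.trans (e3.symm.trans ?_)
    rw [← inner_conj_symm, ← inner_conj_symm (𝕜 := ℂ) (V i _)]
    exact congrArg _ e4

end endo

/-- `β(T) = ∑ᵢ r(vᵢ) T r(vᵢ)*`. -/
noncomputable def beta (ι : Type u) : FockOp ι →⋆ₙₐ[ℂ] FockOp ι :=
  endo (rightCreation_orthogonalFamily ι)

/-- `δ = id - β`. -/
noncomputable def delta {ι : Type u} (T : FockOp ι) : FockOp ι := T - beta ι T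

/-! ### Operators of bounded support -/

/-- `P_k = I - β^{k+1}(I)`. -/
noncomputable def proj (ι : Type u) (k : ℕ) : FockOp ι := 1 - (beta ι)^[k + 1] 1

theorem star_iterate_beta_one (ι : Type u) (k : ℕ) :
    star ((beta ι)^[k] 1) = (beta ι)^[k] 1 := by
  induction k with
  | zero => simp
  | succ k ih => rw [Function.iterate_succ_apply', ← map_star, ih]

theorem iterate_beta_mul (ι : Type u) (j k : ℕ) (h : j ≤ k) :
    (beta ι)^[j] 1 * (beta ι)^[k] 1 = (beta ι)^[k] 1 := by
  induction j generalizing k with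
  | zero => simp
  | succ j ih =>
    obtain ⟨m, rfl⟩ : ∃ m, k = m + 1 := ⟨k - 1, by omega⟩
    rw [Function.iterate_succ_apply', Function.iterate_succ_apply', ← map_mul, ih m (by omega)]

theorem iterate_beta_mul' (ι : Type u) (j k : ℕ) (h : j ≤ k) :
    (beta ι)^[k] 1 * (beta ι)^[j] 1 = (beta ι)^[k] 1 := by
  have := congrArg star (iterate_beta_mul ι j k h)
  rwa [star_mul, star_iterate_beta_one, star_iterate_beta_one] at this

theorem star_proj (ι : Type u) (k : ℕ) : star (proj ι k) = proj ι k := by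
  simp only [proj, star_sub, star_one, star_iterate_beta_one]

theorem proj_mul_proj (ι : Type u) {j k : ℕ} (h : j ≤ k) :
    proj ι k * proj ι j = proj ι j := by
  simp only [proj, mul_sub, sub_mul, one_mul, mul_one,
    iterate_beta_mul' ι (j + 1) (k + 1) (by omega)]
  abel

theorem proj_mul_proj' (ι : Type u) {j k : ℕ} (h : j ≤ k) :
    proj ι j * proj ι k = proj ι j := by
  have := congrArg star (proj_mul_proj ι h)
  rwa [star_mul, star_proj, star_proj] at this

/-- The von Neumann algebra `𝔅_k` of operators `T` with `T = P_k T P_k`. -/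
def supp (ι : Type u) (k : ℕ) : Set (FockOp ι) := {T | T = proj ι k * T * proj ι k}

theorem left_of_mem_supp {ι : Type u} {k : ℕ} {T : FockOp ι} (h : T ∈ supp ι k) :
    proj ι k * T = T := by
  have h' : T = proj ι k * T * proj ι k := h
  rw [h', ← mul_assoc, ← mul_assoc, proj_mul_proj ι le_rfl]

theorem right_of_mem_supp {ι : Type u} {k : ℕ} {T : FockOp ι} (h : T ∈ supp ι k) :
    T * proj ι k = T := by
  have h' : T = proj ι k * T * proj ι k := h
  rw [h', mul_assoc, proj_mul_proj ι le_rfl]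

theorem mem_supp_of {ι : Type u} {k : ℕ} {T : FockOp ι} (h1 : proj ι k * T = T)
    (h2 : T * proj ι k = T) : T ∈ supp ι k := by
  change T = proj ι k * T * proj ι k
  rw [h1, h2]

theorem supp_mono {ι : Type u} {j k : ℕ} (h : j ≤ k) : supp ι j ⊆ supp ι k := by
  intro T hT
  refine mem_supp_of ?_ ?_
  · rw [← left_of_mem_supp hT, ← mul_assoc, proj_mul_proj ι h]
  · rw [← right_of_mem_supp hT, mul_assoc, proj_mul_proj' ι h]

/-- The `*`-algebra `𝔅 = ⋃ₖ 𝔅_k` of operators of bounded support. -/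
noncomputable def bddSupp (ι : Type u) : NonUnitalStarSubalgebra ℂ (FockOp ι) where
  carrier := ⋃ k, supp ι k
  add_mem' := by
    intro S T hS hT
    obtain ⟨j, hS⟩ := Set.mem_iUnion.1 hS
    obtain ⟨k, hT⟩ := Set.mem_iUnion.1 hT
    have hS := supp_mono (le_max_left j k) hS
    have hT := supp_mono (le_max_right j k) hT
    refine Set.mem_iUnion.2 ⟨max j k, mem_supp_of ?_ ?_⟩
    · rw [mul_add, left_of_mem_supp hS, left_of_mem_supp hT]
    · rw [add_mul, right_of_mem_supp hS, right_of_mem_supp hT]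
  zero_mem' := Set.mem_iUnion.2 ⟨0, mem_supp_of (by simp) (by simp)⟩
  mul_mem' := by
    intro S T hS hT
    obtain ⟨j, hS⟩ := Set.mem_iUnion.1 hS
    obtain ⟨k, hT⟩ := Set.mem_iUnion.1 hT
    have hS := supp_mono (le_max_left j k) hS
    have hT := supp_mono (le_max_right j k) hT
    refine Set.mem_iUnion.2 ⟨max j k, mem_supp_of ?_ ?_⟩
    · rw [← mul_assoc, left_of_mem_supp hS]
    · rw [mul_assoc, right_of_mem_supp hT]
  smul_mem' := by
    intro c T hT
    obtain ⟨k, hT⟩ := Set.mem_iUnion.1 hT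
    refine Set.mem_iUnion.2 ⟨k, mem_supp_of ?_ ?_⟩
    · rw [mul_smul_comm, left_of_mem_supp hT]
    · rw [smul_mul_assoc, right_of_mem_supp hT]
  star_mem' := by
    intro T hT
    obtain ⟨k, hT⟩ := Set.mem_iUnion.1 hT
    refine Set.mem_iUnion.2 ⟨k, mem_supp_of ?_ ?_⟩
    · conv_lhs => rw [← star_proj, ← star_mul, right_of_mem_supp hT]
    · conv_lhs => rw [← star_proj, ← star_mul, left_of_mem_supp hT]

theorem proj_mul_beta_proj (ι : Type u) (k : ℕ) :
    proj ι (k + 1) * beta ι (proj ι k) = beta ι (proj ι k) := by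
  have h : beta ι (proj ι k) = (beta ι)^[1] 1 - (beta ι)^[k + 2] 1 := by
    rw [proj, map_sub, ← Function.iterate_succ_apply' (beta ι)]
    rfl
  rw [h, proj, sub_mul, one_mul, mul_sub, iterate_beta_mul' ι 1 (k + 1 + 1) (by omega),
    iterate_beta_mul ι (k + 1 + 1) (k + 2) (by omega)]
  simp

theorem beta_mem_bddSupp {ι : Type u} {T : FockOp ι} (hT : T ∈ bddSupp ι) :
    beta ι T ∈ bddSupp ι := by
  obtain ⟨k, hT⟩ := Set.mem_iUnion.1 hT
  have h2 : beta ι (proj ι k) * proj ι (k + 1) = beta ι (proj ι k) := by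
    have := congrArg star (proj_mul_beta_proj ι k)
    rwa [star_mul, ← map_star, star_proj, star_proj] at this
  refine Set.mem_iUnion.2 ⟨k + 1, mem_supp_of ?_ ?_⟩
  · conv_rhs => rw [← left_of_mem_supp hT, map_mul]
    conv_lhs => rw [← left_of_mem_supp hT, map_mul, ← mul_assoc, proj_mul_beta_proj]
  · conv_rhs => rw [← right_of_mem_supp hT, map_mul]
    conv_lhs => rw [← right_of_mem_supp hT, map_mul, mul_assoc, h2]

/-- `δ` as a map of `𝔅` into itself. -/
noncomputable def deltaB {ι : Type u} (B : bddSupp ι) : bddSupp ι :=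
  ⟨delta (B : FockOp ι), sub_mem B.2 (beta_mem_bddSupp B.2)⟩

/-- `A = λ(B) = ∑ᵢ βⁱ(B)`, as a strongly convergent sum. -/
def IsLambda {ι : Type u} (B A : FockOp ι) : Prop :=
  ∀ x : Fock ι, HasSum (fun i : ℕ => (beta ι)^[i] B x) (A x)

theorem iterate_beta_smul {ι : Type u} (c : ℂ) (B : FockOp ι) (i : ℕ) :
    (beta ι)^[i] (c • B) = c • (beta ι)^[i] B := by
  induction i with
  | zero => rfl
  | succ i ih => rw [Function.iterate_succ_apply', ih, map_smul, Function.iterate_succ_apply' (beta ι) i B]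

/-- The space `λ(𝔅)`. -/
noncomputable def lambdaB (ι : Type u) : Submodule ℂ (FockOp ι) where
  carrier := {A | ∃ B ∈ bddSupp ι, IsLambda B A}
  zero_mem' := ⟨0, zero_mem _, fun x => by simp⟩
  add_mem' := by
    rintro A A' ⟨B, hB, h⟩ ⟨B', hB', h'⟩
    refine ⟨B + B', add_mem hB hB', fun x => ?_⟩
    simpa using (h x).add (h' x)
  smul_mem' := by
    rintro c A ⟨B, hB, h⟩
    refine ⟨c • B, SMulMemClass.smul_mem c hB, fun x => ?_⟩
    simpa [iterate_beta_smul] using (h x).const_smul c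

/-! ### Functionals -/

/-- Positivity of a linear functional on the `*`-algebra `𝔅`. -/
def IsPos {ι : Type u} (ω : bddSupp ι →ₗ[ℂ] ℂ) : Prop :=
  ∀ B : bddSupp ι, 0 ≤ ω (star B * B)

/-- `ω` is decreasing if `ω ∘ δ` is positive on `𝔅`. -/
def IsDecreasing {ι : Type u} (ω : bddSupp ι →ₗ[ℂ] ℂ) : Prop :=
  ∀ B : bddSupp ι, 0 ≤ ω (deltaB (star B * B))

/-- Normality (`σ`-weak continuity) of `f` on a von Neumann algebra `S` of operators:
`f(T) = ∑ⱼ ⟨T ξⱼ, ηⱼ⟩` for `T ∈ S`, with `∑ⱼ ‖ξⱼ‖² < ∞` and `∑ⱼ ‖ηⱼ‖² < ∞`. -/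
def IsNormalOn {H : Type*} [NormedAddCommGroup H] [InnerProductSpace ℂ H]
    (S : Set (H →L[ℂ] H)) (f : S → ℂ) : Prop :=
  ∃ ξ η : ℕ → H, Summable (fun j => ‖ξ j‖ ^ 2) ∧ Summable (fun j => ‖η j‖ ^ 2) ∧
    ∀ T : S, HasSum (fun j => ⟪η j, (T : H →L[ℂ] H) (ξ j)⟫_ℂ) (f T)

/-- `ω` is locally normal if its restriction to each `𝔅_k` is normal. -/
def IsLocallyNormal {ι : Type u} (ω : bddSupp ι →ₗ[ℂ] ℂ) : Prop :=
  ∀ k : ℕ, IsNormalOn (supp ι k) fun T => ω ⟨T, Set.mem_iUnion.2 ⟨k, T.2⟩⟩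

/-- `D` is the functional `Δω`: the positive linear functional on the C*-algebra which is the
norm closure of `λ(𝔅)` that extends `ω ∘ δ`. -/
structure IsDelta {ι : Type u} (ω : bddSupp ι →ₗ[ℂ] ℂ)
    (D : (lambdaB ι).topologicalClosure →ₗ[ℂ] ℂ) : Prop where
  nonneg : ∀ A : (lambdaB ι).topologicalClosure, 0 ≤ (A : FockOp ι) → 0 ≤ D A
  extends_delta : ∀ (A : FockOp ι) (hA : A ∈ lambdaB ι), ∃ h : delta A ∈ bddSupp ι,
    D ⟨A, (lambdaB ι).le_topologicalClosure hA⟩ = ω ⟨delta A, h⟩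

section algebra

variable {ι : Type u} {A : Type v} [CStarAlgebra A] [PartialOrder A]

/-- `ω` is a decreasing locally normal positive linear functional on `𝔅` with `ρ = Δω ∘ l`. -/
structure Represents {v : ι → A} (hv : IsToeplitzCuntz v) (ω : bddSupp ι →ₗ[ℂ] ℂ)
    (ρ : A →ₚ[ℂ] ℂ) : Prop where
  pos : IsPos ω
  decreasing : IsDecreasing ω
  locallyNormal : IsLocallyNormal ω
  eq_delta_comp : ∃ D, IsDelta ω D ∧
    ∀ a : A, ∃ h : fockRep hv a ∈ (lambdaB ι).topologicalClosure, ρ a = D ⟨fockRep hv a, h⟩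

variable [StarOrderedRing A]

/-- With `π` the GNS representation of `σ`: `∑ᵢ π(vᵢ vᵢ*) = I` strongly. -/
def IsEssential (v : ι → A) (σ : A →ₚ[ℂ] ℂ) : Prop :=
  ∀ x : σ.GNS, HasSum (fun i => σ.gnsStarAlgHom (v i * star (v i)) x) x

/-- With `π` the GNS representation of `σ`: the projections `∑_{|μ| = k} π(v_μ v_μ*)`
(strong sums) converge strongly to `0` as `k → ∞`. -/
def IsSingular (v : ι → A) (σ : A →ₚ[ℂ] ℂ) : Prop :=
  ∀ x : σ.GNS, ∃ s : ℕ → σ.GNS,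
    (∀ k, HasSum (fun μ : {μ : List ι // μ.length = k} =>
      σ.gnsStarAlgHom (word v μ * star (word v μ)) x) (s k)) ∧
    Filter.Tendsto s Filter.atTop (𝓝 0)

/-- `ρ = σ + τ` with `σ` singular and `τ` essential. -/
structure IsDecomposition (v : ι → A) (ρ σ τ : A →ₚ[ℂ] ℂ) : Prop where
  singular : IsSingular v σ
  essential : IsEssential v τ
  eq_add : ρ = σ + τ

/-- `σ` is the singular part of `ρ`: the singular component in the unique decomposition of `ρ`
into a singular and an essential positive functional. -/
def IsSingularPart (v : ι → A) (ρ σ : A →ₚ[ℂ] ℂ) : Prop :=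
  ∃ τ, IsDecomposition v ρ σ τ ∧ ∀ σ' τ', IsDecomposition v ρ σ' τ' → σ' = σ ∧ τ' = τ

/-- The functional `φ ∘ l`. -/
noncomputable def compFockRep {v : ι → A} (hv : IsToeplitzCuntz v)
    (φ : FockOp ι →ₚ[ℂ] ℂ) : A →ₚ[ℂ] ℂ :=
  φ.comp (PositiveLinearMap.ofClass (fockRep hv))

end algebra

/-- `φ` is a normal positive functional on all bounded operators extending `ω ∘ δ` on `𝔅`. -/
structure IsNormalExtension {ι : Type u} (ω : bddSupp ι →ₗ[ℂ] ℂ) (φ : FockOp ι →ₚ[ℂ] ℂ) :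
    Prop where
  normal : IsNormalOn (Set.univ : Set (FockOp ι)) fun T => φ T.1
  extends_delta : ∀ B : bddSupp ι, φ (B : FockOp ι) = ω (deltaB B)

end TC

namespace TC

open Filter

/-! ### Coordinates on Fock space -/

section coordinates

variable {ι : Type u}

-- Everything is read off from the GNS representation `π` of `ρ` with cyclic vector `ξ`. Put `h_μ =
-- π(v_μ)* ξ`, let `Q_k = ∑_{|μ|=k} π(v_μ v_μ*)`, and consider the moments `m_k(α, β) = ⟨h_α, Q_k
-- h_β⟩`. They satisfy `m_0(α, β) = ρ(v_α v_β*)` and `m_{k+1}(α, β) = ∑ᵢ m_k(αi, βi)`, the same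
-- recursion that `β` performs on the matrix units `e_α e_β*`.
--
-- Uniqueness of `ω`: since `λ(e_α e_β*) = l(v_α v_β*)` and `δ` inverts `λ`, the relation `ρ = Δω ∘
-- l` forces `ω(e_α e_β*) = ρ(v_α v_β*)`. A normal functional is continuous for bounded strong
-- convergence, and finite compressions approximate every operator in this sense, so matrix units
-- determine a locally normal functional (`IsLocallyNormal.ext`). The same argument gives uniqueness
-- of `φ`.
--
-- Existence of `ω` and `φ`: every square-summable family of vectors is the Gram data of a normal
-- positive functional on the bounded operators of Fock space (`exists_normal_of_gram`). The vectors
-- `h_μ` with `|μ| ≤ N` are square-summable and give `ω` on `𝔅_N`. The defect vectors `(1 - Q_1)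
-- h_μ` are square-summable over all words, because `‖(1 - Q_1) h_μ‖² = ‖h_μ‖² - ∑ᵢ ‖h_{μi}‖²`
-- telescopes along the tree of words. Their Gram matrix is `m_0 - m_1`, so the normal positive
-- functional `φ` they define restricts to `ω ∘ δ` (`omegaFun_deltaB`); in particular `ω` is
-- decreasing.
--
-- Existence of `Δω`: telescoping `ω - ω ∘ β = φ` gives `ω(βⁱ B) → ω(B) - φ(λ(B))`. This limit is
-- also the limit of the means `ω_N(λ(B)) / (N + 1)`, where `ω_N` is the positive functional `T ↦
-- ω(P_N T P_N)`. A limit of these means along an ultrafilter is therefore a positive functional `D`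
-- on all bounded operators with `φ + D = ω ∘ δ` on `λ(𝔅)` (`exists_essentialFun`), and `Δω` is the
-- restriction of `φ + D`.
--
-- Decomposition: hence `ρ = φ ∘ l + D ∘ l`, with `D(l(v_α v_β*)) = lim_k m_k(α, β)`. These limits
-- are invariant under the recursion, so `D ∘ l` is essential. Moments are additive in the
-- functional (`moment_add`), so those of `φ ∘ l` at the cyclic vector tend to zero and `φ ∘ l` is
-- singular. For any decomposition `ρ = σ + τ` into singular and essential parts, additivity gives
-- `m_k(α, β) → τ(v_α v_β*)`, which determines `τ`, and then `σ`.

theorem inner_fockBasis_left (μ : List ι) (x : Fock ι) : ⟪fockBasis μ, x⟫_ℂ = x μ := by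
  classical
  unfold fockBasis
  rw [lp.inner_single_left]
  simp

theorem inner_fockBasis_right (μ : List ι) (x : Fock ι) :
    ⟪x, fockBasis μ⟫_ℂ = starRingEnd ℂ (x μ) := by
  rw [← inner_conj_symm, inner_fockBasis_left]

theorem fockBasis_apply_self (μ : List ι) : fockBasis μ μ = 1 := by
  classical
  unfold fockBasis
  exact lp.single_apply_self ..

theorem fockBasis_apply_ne {μ ν : List ι} (h : ν ≠ μ) : fockBasis μ ν = 0 := by
  classical
  unfold fockBasis
  exact lp.single_apply_ne _ _ _ h

theorem hasSum_fockBasis (x : Fock ι) : HasSum (fun μ => x μ • fockBasis μ) x := by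
  classical
  have := lp.hasSum_single (p := 2) (by simp) x
  convert this using 2 with μ
  unfold fockBasis
  rw [← lp.single_smul]
  simp

theorem fock_ext {x y : Fock ι} (h : ∀ μ, x μ = y μ) : x = y := lp.ext (funext h)

theorem hasSum_norm_sq_coord (x : Fock ι) : HasSum (fun μ => ‖x μ‖ ^ 2) (‖x‖ ^ 2) := by
  have := lp.hasSum_norm (p := 2) (by simp) x
  simpa using this

theorem adj_rightCreation_apply (i : ι) (x : Fock ι) (μ : List ι) :
    adj (rightCreation i) x μ = x (μ ++ [i]) := by
  rw [← inner_fockBasis_left, ContinuousLinearMap.adjoint_inner_right]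
  change ⟪rightCreation i (fockBasis μ), x⟫_ℂ = _
  rw [rightCreation, shift_fockBasis, inner_fockBasis_left]

theorem leftCreation_fockBasis (i : ι) (μ : List ι) :
    leftCreation i (fockBasis μ) = fockBasis (i :: μ) := shift_fockBasis _ _ _

theorem rightCreation_fockBasis (i : ι) (μ : List ι) :
    rightCreation i (fockBasis μ) = fockBasis (μ ++ [i]) := shift_fockBasis _ _ _

theorem hasSum_beta (T : FockOp ι) (x : Fock ι) :
    HasSum (fun i => rightCreation i (T (adj (rightCreation i) x))) (beta ι T x) :=
  hasSum_endoFun (rightCreation_orthogonalFamily ι) T x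

theorem adj_rightCreation_beta (T : FockOp ι) (x : Fock ι) (i : ι) :
    adj (rightCreation i) (beta ι T x) = T (adj (rightCreation i) x) :=
  adjoint_endoFun (rightCreation_orthogonalFamily ι) T x i

theorem beta_apply_append (T : FockOp ι) (x : Fock ι) (μ : List ι) (i : ι) :
    beta ι T x (μ ++ [i]) = T (adj (rightCreation i) x) μ := by
  rw [← adj_rightCreation_apply, adj_rightCreation_beta]

theorem beta_apply_nil (T : FockOp ι) (x : Fock ι) : beta ι T x [] = 0 := by
  rw [← inner_fockBasis_left]
  refine ((hasSum_beta T x).mapL (innerSL ℂ (fockBasis []))).unique ?_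
  convert hasSum_zero with i
  simp only [innerSL_apply_apply]
  rw [← inner_conj_symm]
  have := ContinuousLinearMap.adjoint_inner_right (rightCreation i).toContinuousLinearMap
    (T (adj (rightCreation i) x)) (fockBasis [])
  change _ = ⟪rightCreation i (T (adj (rightCreation i) x)), fockBasis []⟫_ℂ at this
  rw [← this]
  have h0 : adj (rightCreation i) (fockBasis []) = 0 := by
    refine fock_ext fun μ => ?_
    rw [adj_rightCreation_apply, fockBasis_apply_ne (by simp)]
    rfl
  rw [h0]
  simp

theorem iterate_beta_one_apply (n : ℕ) (x : Fock ι) (μ : List ι) :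
    (beta ι)^[n] 1 x μ = if n ≤ μ.length then x μ else 0 := by
  induction n generalizing x μ with
  | zero => simp
  | succ n ih =>
    rw [Function.iterate_succ_apply']
    rcases List.eq_nil_or_concat' μ with rfl | ⟨ν, i, rfl⟩
    · rw [beta_apply_nil]; simp
    · rw [beta_apply_append, ih, adj_rightCreation_apply]
      simp

theorem proj_apply (k : ℕ) (x : Fock ι) (μ : List ι) :
    proj ι k x μ = if μ.length ≤ k then x μ else 0 := by
  have : proj ι k x μ = x μ - (beta ι)^[k + 1] 1 x μ := rfl
  rw [this, iterate_beta_one_apply]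
  split_ifs <;> first | omega | simp

/-- The matrix unit `e_α e_β^*`. -/
noncomputable def matrixUnit (α β : List ι) : FockOp ι :=
  InnerProductSpace.rankOne ℂ (fockBasis α) (fockBasis β)

theorem matrixUnit_apply (α β : List ι) (x : Fock ι) :
    matrixUnit α β x = x β • fockBasis α := by
  rw [matrixUnit, InnerProductSpace.rankOne_apply, inner_fockBasis_left]

theorem matrixUnit_mem_supp {α β : List ι} {k : ℕ} (hα : α.length ≤ k) (hβ : β.length ≤ k) :
    matrixUnit α β ∈ supp ι k := by
  refine mem_supp_of ?_ ?_ <;> ext1 x <;> refine fock_ext fun μ => ?_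
  · rw [mul_apply_eq_comp, proj_apply, matrixUnit_apply]
    by_cases h : μ = α
    · subst h; simp [hα]
    · rw [lp.coeFn_smul, Pi.smul_apply, fockBasis_apply_ne h]; simp
  · rw [mul_apply_eq_comp, matrixUnit_apply, matrixUnit_apply, proj_apply, if_pos hβ]

theorem mem_bddSupp {T : FockOp ι} : T ∈ bddSupp ι ↔ ∃ k, T ∈ supp ι k := Set.mem_iUnion

theorem mem_bddSupp_of_supp {T : FockOp ι} {k : ℕ} (h : T ∈ supp ι k) : T ∈ bddSupp ι :=
  mem_bddSupp.2 ⟨k, h⟩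

theorem matrixUnit_mem_bddSupp (α β : List ι) : matrixUnit α β ∈ bddSupp ι :=
  mem_bddSupp_of_supp (matrixUnit_mem_supp (le_max_left _ _) (le_max_right _ _))

theorem compress_mem_supp (k : ℕ) (T : FockOp ι) : proj ι k * T * proj ι k ∈ supp ι k :=
  mem_supp_of (by rw [← mul_assoc, ← mul_assoc, proj_mul_proj ι le_rfl])
    (by rw [mul_assoc, proj_mul_proj ι le_rfl])

/-- Compressing a matrix unit by `P_k` gives back the matrix unit or zero. -/
theorem compress_matrixUnit (k : ℕ) (α β : List ι) :
    proj ι k * matrixUnit α β * proj ι k =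
      if α.length ≤ k ∧ β.length ≤ k then matrixUnit α β else 0 := by
  split_ifs with h
  · exact (matrixUnit_mem_supp h.1 h.2).symm
  · ext1 x
    refine fock_ext fun μ => ?_
    rw [mul_apply_eq_comp, mul_apply_eq_comp, matrixUnit_apply, proj_apply, proj_apply]
    by_cases hμ : μ = α
    · subst hμ
      by_cases hα : μ.length ≤ k
      · have hβ : ¬ β.length ≤ k := fun hβ => h ⟨hα, hβ⟩
        simp [hβ]
      · simp [hα]
    · rw [lp.coeFn_smul, Pi.smul_apply, fockBasis_apply_ne hμ]; simp

theorem rightCreation_matrixUnit_adj (i : ι) (α β : List ι) (x : Fock ι) :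
    rightCreation i (matrixUnit α β (adj (rightCreation i) x)) =
      matrixUnit (α ++ [i]) (β ++ [i]) x := by
  rw [matrixUnit_apply, matrixUnit_apply, adj_rightCreation_apply, map_smul,
    rightCreation_fockBasis]

end coordinates

/-! ### Bounded strong convergence and normal functionals -/

section strong

variable {H : Type*} [NormedAddCommGroup H] [InnerProductSpace ℂ H]

/-- The operators `F a` are uniformly bounded and converge strongly to `T` along `l`. -/
def BStrong {κ : Type*} (l : Filter κ) (F : κ → H →L[ℂ] H) (T : H →L[ℂ] H) : Prop :=
  (∃ C, ∀ a, ‖F a‖ ≤ C) ∧ ∀ x, Tendsto (fun a => F a x) l (𝓝 (T x))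

theorem BStrong.mul_mul {κ : Type*} {l : Filter κ} {F : κ → H →L[ℂ] H} {T : H →L[ℂ] H}
    (h : BStrong l F T) (P Q : H →L[ℂ] H) : BStrong l (fun a => P * F a * Q) (P * T * Q) := by
  obtain ⟨⟨C, hC⟩, h⟩ := h
  refine ⟨⟨‖P‖ * C * ‖Q‖, fun a => ?_⟩, fun x => ?_⟩
  · refine (norm_mul_le _ _).trans ?_
    gcongr
    refine (norm_mul_le _ _).trans ?_
    gcongr
    exact hC a
  · exact (P.continuous.tendsto _).comp (h (Q x))

theorem BStrong.of_tendsto_nat [CompleteSpace H] {F : ℕ → H →L[ℂ] H} {T : H →L[ℂ] H}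
    (h : ∀ x, Tendsto (fun n => F n x) atTop (𝓝 (T x))) : BStrong atTop F T := by
  refine ⟨banach_steinhaus fun x => ?_, h⟩
  obtain ⟨C, hC⟩ := (h x).norm.bddAbove_range
  exact ⟨C, fun i => hC ⟨i, rfl⟩⟩

/-- Normal functionals are continuous for bounded strong convergence. -/
theorem IsNormalOn.tendsto {S : Set (H →L[ℂ] H)} {f : S → ℂ} (hf : IsNormalOn S f) {κ : Type*}
    {l : Filter κ} {F : κ → S} {T : S} (h : BStrong l (fun a => (F a : H →L[ℂ] H)) T) :
    Tendsto (fun a => f (F a)) l (𝓝 (f T)) := by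
  obtain ⟨ξ, η, hξ, hη, hf⟩ := hf
  obtain ⟨⟨C, hC⟩, h⟩ := h
  simp only [← fun T => (hf T).tsum_eq]
  -- The inequality between `‖ξ‖ ‖η‖` and the sum of squares turns the uniform operator bound into a
  -- summable dominating sequence, so the limit may be taken term by term.
  refine tendsto_tsum_of_dominated_convergence
    (bound := fun j => C * (‖ξ j‖ ^ 2 + ‖η j‖ ^ 2)) ((hξ.add hη).mul_left C)
    (fun j => ((innerSL ℂ (η j)).continuous.tendsto _).comp (h (ξ j))) (.of_forall fun a j => ?_)
  have hC0 : 0 ≤ C := (norm_nonneg _).trans (hC a)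
  calc _ ≤ ‖η j‖ * ‖(F a : H →L[ℂ] H) (ξ j)‖ := norm_inner_le_norm _ _
    _ ≤ ‖η j‖ * (C * ‖ξ j‖) := by
        gcongr
        exact (ContinuousLinearMap.le_opNorm _ _).trans (by gcongr; exact hC a)
    _ ≤ _ := by nlinarith [sq_nonneg (‖ξ j‖ - ‖η j‖), sq_nonneg ‖ξ j‖, sq_nonneg ‖η j‖]

theorem IsNormalOn.tendsto_univ {f : (H →L[ℂ] H) → ℂ}
    (hf : IsNormalOn (Set.univ : Set (H →L[ℂ] H)) fun T => f T.1) {κ : Type*}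
    {l : Filter κ} {F : κ → H →L[ℂ] H} {T : H →L[ℂ] H} (h : BStrong l F T) :
    Tendsto (fun a => f (F a)) l (𝓝 (f T)) :=
  hf.tendsto (F := fun a => ⟨F a, Set.mem_univ _⟩) (T := ⟨T, Set.mem_univ _⟩) h

theorem hasSum_norm_sq_of_orthogonalFamily {ι : Type*} {V : ι → H →ₗᵢ[ℂ] H}
    (hV : OrthogonalFamily ℂ (fun _ : ι => H) V) {g : ι → H} {y : H}
    (h : HasSum (fun i => V i (g i)) y) : HasSum (fun i => ‖g i‖ ^ 2) (‖y‖ ^ 2) := by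
  have := (h.norm.pow 2)
  refine this.congr fun s => ?_
  exact hV.norm_sum g s

end strong

-- Continuity of `β` and approximation by matrix units.

section fock

variable {ι : Type u}

theorem hasSum_norm_sq_beta (T : FockOp ι) (x : Fock ι) :
    HasSum (fun i => ‖T (adj (rightCreation i) x)‖ ^ 2) (‖beta ι T x‖ ^ 2) :=
  hasSum_norm_sq_of_orthogonalFamily (rightCreation_orthogonalFamily ι) (hasSum_beta T x)

theorem norm_beta_le (T : FockOp ι) : ‖beta ι T‖ ≤ ‖T‖ :=
  ContinuousLinearMap.opNorm_le_bound _ (norm_nonneg _)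
    (norm_endo_le (rightCreation_orthogonalFamily ι) T)

/-- The ranges of the `r(vᵢ)` are orthogonal, so `‖β(S) x‖² = ∑ᵢ ‖S r(vᵢ)* x‖²`. With `S = F a - T`
each term tends to zero, and uniform boundedness dominates the series by a multiple of `∑ᵢ ‖r(vᵢ)*
x‖²`. -/
theorem BStrong.beta {κ : Type*} {l : Filter κ} {F : κ → FockOp ι} {T : FockOp ι}
    (h : BStrong l F T) : BStrong l (fun a => beta ι (F a)) (beta ι T) := by
  obtain ⟨⟨C, hC⟩, h⟩ := h
  refine ⟨⟨C, fun a => (norm_beta_le _).trans (hC a)⟩, fun x => ?_⟩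
  rw [tendsto_iff_norm_sub_tendsto_zero]
  have key : Tendsto (fun a => ∑' i, ‖(F a - T) (adj (rightCreation i) x)‖ ^ 2) l
      (𝓝 (∑' _ : ι, 0)) := by
    refine tendsto_tsum_of_dominated_convergence
      (bound := fun i => (C + ‖T‖) ^ 2 * ‖adj (rightCreation i) x‖ ^ 2) ?_ (fun i => ?_)
      (.of_forall fun a i => ?_)
    · refine Summable.mul_left _ ?_
      simpa using (hasSum_norm_sq_beta (1 : FockOp ι) x).summable
    · have := (tendsto_iff_norm_sub_tendsto_zero.1 (h (adj (rightCreation i) x))).pow 2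
      simpa using this
    · rw [norm_pow, norm_norm, ← mul_pow]
      gcongr
      refine (ContinuousLinearMap.le_opNorm _ _).trans ?_
      gcongr
      exact (norm_sub_le _ _).trans (by gcongr; exact hC a)
  have key2 := key.sqrt
  simp only [tsum_zero, Real.sqrt_zero] at key2
  refine key2.congr fun a => ?_
  rw [(hasSum_norm_sq_beta (F a - T) x).tsum_eq, Real.sqrt_sq (norm_nonneg _), map_sub]
  rfl

theorem BStrong.iterate_beta {κ : Type*} {l : Filter κ} {F : κ → FockOp ι} {T : FockOp ι}
    (h : BStrong l F T) (i : ℕ) : BStrong l (fun a => (TC.beta ι)^[i] (F a)) ((TC.beta ι)^[i] T) := by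
  induction i with
  | zero => exact h
  | succ i ih => simp only [Function.iterate_succ_apply']; exact ih.beta

/-- The partial sums of `∑ᵢ r(vᵢ) T r(vᵢ)*`. -/
noncomputable def betaPartial (T : FockOp ι) (s : Finset ι) : FockOp ι :=
  ∑ i ∈ s, (rightCreation i).toContinuousLinearMap * T * adj (rightCreation i)

theorem bStrong_betaPartial (T : FockOp ι) : BStrong atTop (betaPartial T) (beta ι T) := by
  have e : ∀ s x, betaPartial T s x = ∑ i ∈ s, rightCreation i (T (adj (rightCreation i) x)) := by
    intro s x
    simp [betaPartial]
  refine ⟨⟨‖T‖, fun s => ?_⟩, fun x => ?_⟩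
  · refine ContinuousLinearMap.opNorm_le_bound _ (norm_nonneg _) fun x => ?_
    have h1 := (rightCreation_orthogonalFamily ι).norm_sum
      (fun i => T (adj (rightCreation i) x)) s
    have h2 := sum_apply_adjoint_sq_le (rightCreation_orthogonalFamily ι) T x s
    rw [← h1] at h2
    rw [e]
    exact (sq_le_sq₀ (norm_nonneg _) (by positivity)).1 h2
  · simp only [e]
    exact hasSum_beta T x

theorem betaPartial_matrixUnit (α β : List ι) (s : Finset ι) :
    betaPartial (matrixUnit α β) s = ∑ i ∈ s, matrixUnit (α ++ [i]) (β ++ [i]) := by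
  refine Finset.sum_congr rfl fun i _ => ?_
  ext1 x
  exact rightCreation_matrixUnit_adj i α β x

/-- Coordinate projections on finitely many basis vectors. -/
noncomputable def coordProj (s : Finset (List ι)) : FockOp ι := ∑ μ ∈ s, matrixUnit μ μ

theorem coordProj_apply (s : Finset (List ι)) (x : Fock ι) :
    coordProj s x = ∑ μ ∈ s, x μ • fockBasis μ := by
  simp [coordProj, matrixUnit_apply]

theorem norm_coordProj_apply_le (s : Finset (List ι)) (x : Fock ι) : ‖coordProj s x‖ ≤ ‖x‖ := by
  rw [coordProj_apply]
  have h := fockBasis_orthonormal.inner_sum (𝕜 := ℂ) (fun μ : List ι => x μ) (fun μ => x μ) s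
  rw [inner_self_eq_norm_sq_to_K] at h
  have h1 : ‖∑ μ ∈ s, x μ • fockBasis μ‖ ^ 2 = ∑ μ ∈ s, ‖x μ‖ ^ 2 := by
    have : ∀ μ, starRingEnd ℂ (x μ) * x μ = ((‖x μ‖ ^ 2 : ℝ) : ℂ) := fun μ => by
      rw [← Complex.normSq_eq_conj_mul_self, Complex.normSq_eq_norm_sq]
    simp only [this] at h
    refine Complex.ofReal_injective ?_
    rw [Complex.ofReal_pow, Complex.ofReal_sum]
    exact h
  refine (sq_le_sq₀ (norm_nonneg _) (norm_nonneg _)).1 ?_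
  rw [h1]
  exact sum_le_hasSum s (fun _ _ => by positivity) (hasSum_norm_sq_coord x)

theorem tendsto_coordProj_apply (x : Fock ι) :
    Tendsto (fun s => coordProj s x) atTop (𝓝 x) := by
  simp only [coordProj_apply]
  exact hasSum_fockBasis x

theorem norm_coordProj_le (s : Finset (List ι)) : ‖coordProj s‖ ≤ 1 :=
  ContinuousLinearMap.opNorm_le_bound _ zero_le_one fun x => by
    rw [one_mul]; exact norm_coordProj_apply_le s x

theorem bStrong_coordProj (T : FockOp ι) :
    BStrong atTop (fun s => coordProj s * T * coordProj s) T := by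
  refine ⟨⟨‖T‖, fun s => ?_⟩, fun x => ?_⟩
  · refine (norm_mul_le _ _).trans ?_
    have h1 := norm_mul_le (coordProj s) T
    have h2 := norm_coordProj_le s
    have h3 : ‖coordProj s * T‖ ≤ ‖T‖ := by nlinarith [norm_nonneg T]
    nlinarith [norm_nonneg T, norm_nonneg (coordProj s), norm_nonneg (coordProj s * T)]
  · have h1 : Tendsto (fun s => coordProj s (T (coordProj s x) - T x)) atTop (𝓝 0) := by
      refine squeeze_zero_norm (fun s => norm_coordProj_apply_le s _) ?_
      exact tendsto_iff_norm_sub_tendsto_zero.1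
        ((T.continuous.tendsto x).comp (tendsto_coordProj_apply x))
    have h2 := h1.add (tendsto_coordProj_apply (T x))
    rw [zero_add] at h2
    refine h2.congr fun s => ?_
    rw [← map_add, sub_add_cancel]
    rfl

theorem coordProj_mul_mul (T : FockOp ι) (s : Finset (List ι)) :
    coordProj s * T * coordProj s =
      ∑ β ∈ s, ∑ α ∈ s, T (fockBasis β) α • matrixUnit α β := by
  ext1 x
  rw [mul_apply_eq_comp, mul_apply_eq_comp, coordProj_apply s x, map_sum, map_sum,
    sum_apply]
  refine Finset.sum_congr rfl fun β _ => ?_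
  rw [map_smul, map_smul, coordProj_apply, sum_apply, Finset.smul_sum]
  refine Finset.sum_congr rfl fun α _ => ?_
  rw [smul_apply, matrixUnit_apply, smul_comm]

/-- A linear functional continuous for bounded strong convergence is determined by the matrix
units. -/
theorem eq_of_matrixUnit {f g : FockOp ι →ₗ[ℂ] ℂ}
    (hf : ∀ T, Tendsto (fun s => f (coordProj s * T * coordProj s)) atTop (𝓝 (f T)))
    (hg : ∀ T, Tendsto (fun s => g (coordProj s * T * coordProj s)) atTop (𝓝 (g T)))
    (h : ∀ α β, f (matrixUnit α β) = g (matrixUnit α β)) : f = g := by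
  refine LinearMap.ext fun T => tendsto_nhds_unique (hf T) ((hg T).congr fun s => ?_)
  simp only [coordProj_mul_mul, map_sum, map_smul, h]

end fock

/-! ### Positive functionals -/

section positive

variable {A : Type*} [CStarAlgebra A] [PartialOrder A] [StarOrderedRing A]

/-- This is Cauchy–Schwarz in the pre-GNS space, where `f a` is the matrix coefficient of left
multiplication by `a` at the vector of `1`. -/
theorem norm_apply_le_of_positive (f : A →ₚ[ℂ] ℂ) (a : A) : ‖f a‖ ≤ (f 1).re * ‖a‖ := by
  have h1 : f a = ⟪f.toPreGNS 1, f.leftMulMapPreGNS a (f.toPreGNS 1)⟫_ℂ := by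
    simp [PositiveLinearMap.preGNS_inner_def]
  have h2 : ‖f.leftMulMapPreGNS a‖ ≤ ‖a‖ :=
    LinearMap.mkContinuous_norm_le _ (norm_nonneg _) _
  have h3 : ‖f.toPreGNS 1‖ ^ 2 = (f 1).re := by
    have := congrArg Complex.re (f.preGNS_norm_sq (f.toPreGNS 1))
    rw [← Complex.ofReal_pow, Complex.ofReal_re] at this
    simpa using this
  rw [h1, ← h3]
  calc _ ≤ ‖f.toPreGNS 1‖ * ‖f.leftMulMapPreGNS a (f.toPreGNS 1)‖ := norm_inner_le_norm _ _
    _ ≤ ‖f.toPreGNS 1‖ * (‖a‖ * ‖f.toPreGNS 1‖) := by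
        gcongr
        exact (ContinuousLinearMap.le_opNorm _ _).trans (by gcongr)
    _ = _ := by ring

theorem continuous_of_positive (f : A →ₚ[ℂ] ℂ) : Continuous f :=
  AddMonoidHomClass.continuous_of_bound f _ (norm_apply_le_of_positive f)

end positive

/-! ### Normal positive functionals from square-summable families -/

section reindex

/-- Normality asks for sequences, whereas a Hilbert basis may have any index set. A square-summable
family has countable support, so it can be placed inside `ℕ` and padded by zeros; the condition `g 0
= 0` makes the padding harmless. -/
theorem exists_nat_reindex {κ : Type*} {E : Type*} [NormedAddCommGroup E] (x : κ → E)
    (hx : Summable fun j => ‖x j‖ ^ 2) :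
    ∃ y : ℕ → E, (Summable fun n => ‖y n‖ ^ 2) ∧
      ∀ (g : E → ℂ) (a : ℂ), g 0 = 0 → HasSum (fun j => g (x j)) a →
        HasSum (fun n => g (y n)) a := by
  have hc : (Function.support x).Countable := by
    refine hx.countable_support.mono fun j hj => ?_
    simpa using hj
  have := hc.to_subtype
  obtain ⟨e, he⟩ := exists_injective_nat (Function.support x)
  have hext : ∀ {F : Type _} [Zero F] (g : E → F), g 0 = 0 →
      (fun n => g (Function.extend e (fun j => x j) 0 n)) =
        Function.extend e (fun j => g (x j)) 0 := by
    intro F _ g hg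
    funext n
    by_cases h : ∃ j, e j = n
    · obtain ⟨j, rfl⟩ := h
      rw [he.extend_apply, he.extend_apply]
    · rw [Function.extend_apply' _ _ _ h, Function.extend_apply' _ _ _ h]
      exact hg
  refine ⟨Function.extend e (fun j => x j) 0, ?_, fun g a hg h => ?_⟩
  · rw [hext (fun y => ‖y‖ ^ 2) (by simp)]
    exact ((hasSum_extend_zero he).2 (hx.subtype _).hasSum).summable
  · rw [hext g hg, hasSum_extend_zero he]
    refine (hasSum_subtype_iff_of_support_subset (f := fun j => g (x j)) fun j hj => ?_).2 h
    intro h0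
    exact hj (by simp [h0, hg])

end reindex

section vectorFunctional

variable {H : Type*} [NormedAddCommGroup H] [InnerProductSpace ℂ H]

theorem summable_inner_apply {x : ℕ → H} (hx : Summable fun n => ‖x n‖ ^ 2) (T : H →L[ℂ] H) :
    Summable fun n => ⟪x n, T (x n)⟫_ℂ := by
  refine Summable.of_norm_bounded (hx.mul_left ‖T‖) fun n => ?_
  calc _ ≤ ‖x n‖ * ‖T (x n)‖ := norm_inner_le_norm _ _
    _ ≤ ‖x n‖ * (‖T‖ * ‖x n‖) := by gcongr; exact T.le_opNorm _
    _ = _ := by ring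

/-- The normal positive functional `T ↦ ∑ₙ ⟨xₙ, T xₙ⟩`. -/
noncomputable def vectorFunctional [CompleteSpace H] {x : ℕ → H}
    (hx : Summable fun n => ‖x n‖ ^ 2) : (H →L[ℂ] H) →ₚ[ℂ] ℂ :=
  PositiveLinearMap.mk₀
    { toFun := fun T => ∑' n, ⟪x n, T (x n)⟫_ℂ
      map_add' := fun S T => by
        rw [← (summable_inner_apply hx S).tsum_add (summable_inner_apply hx T)]
        simp
      map_smul' := fun c T => by
        rw [RingHom.id_apply, smul_eq_mul, ← (summable_inner_apply hx T).tsum_mul_left]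
        simp }
    fun T hT => by
      refine tsum_nonneg fun n => ?_
      exact ((ContinuousLinearMap.nonneg_iff_isPositive T).1 hT).inner_nonneg_right (x n)

theorem hasSum_vectorFunctional [CompleteSpace H] {x : ℕ → H}
    (hx : Summable fun n => ‖x n‖ ^ 2) (T : H →L[ℂ] H) :
    HasSum (fun n => ⟪x n, T (x n)⟫_ℂ) (vectorFunctional hx T) :=
  (summable_inner_apply hx T).hasSum

end vectorFunctional

section gram

variable {ι : Type u} {H : Type*} [NormedAddCommGroup H] [InnerProductSpace ℂ H]

theorem hasSum_norm_sq_hilbertBasis {κ : Type*} (b : HilbertBasis κ ℂ H) (y : H) :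
    HasSum (fun j => ‖⟪b j, y⟫_ℂ‖ ^ 2) (‖y‖ ^ 2) := by
  have := lp.hasSum_norm (p := 2) (by simp) (b.repr y)
  simpa [b.repr_apply_apply] using this

/-- A square-summable family `h` is the Gram data of a normal positive functional. -/
theorem exists_normal_of_gram [CompleteSpace H] (h : List ι → H) (hs : Summable fun μ => ‖h μ‖ ^ 2) :
    ∃ f : FockOp ι →ₚ[ℂ] ℂ, (IsNormalOn (Set.univ : Set (FockOp ι)) fun T => f T.1) ∧
      ∀ α β, f (matrixUnit α β) = ⟪h α, h β⟫_ℂ := by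
  obtain ⟨w, b, -⟩ := exists_hilbertBasis ℂ H
  have hmem : ∀ j, Memℓp (fun μ => ⟪b j, h μ⟫_ℂ) 2 := fun j => by
    refine memℓp_gen ?_
    refine Summable.of_nonneg_of_le (fun μ => by positivity) (fun μ => ?_) hs
    simp only [ENNReal.toReal_ofNat, Real.rpow_ofNat]
    gcongr
    refine (norm_inner_le_norm _ _).trans ?_
    rw [b.orthonormal.1 j, one_mul]
  -- The coordinates of `h` are transposed: `x j` collects the `j`-th coordinates of all the `h μ`.
  -- By Tonelli `∑ⱼ ‖x j‖² = ∑_μ ‖h μ‖²`, and Parseval turns `∑ⱼ ⟨x j, e_α e_β* x j⟩` into `⟨h α, h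
  -- β⟩`.
  let x : w → Fock ι := fun j => ⟨fun μ => ⟪b j, h μ⟫_ℂ, hmem j⟩
  have hx : Summable fun j => ‖x j‖ ^ 2 := by
    have h1 : Summable fun p : List ι × w => ‖⟪b p.2, h p.1⟫_ℂ‖ ^ 2 := by
      refine (summable_prod_of_nonneg fun p => by positivity).2
        ⟨fun μ => (hasSum_norm_sq_hilbertBasis b (h μ)).summable, ?_⟩
      simpa only [(hasSum_norm_sq_hilbertBasis b _).tsum_eq] using hs
    have h2 := ((summable_prod_of_nonneg fun p => sq_nonneg _).1
      ((Equiv.prodComm w (List ι)).summable_iff.2 h1)).2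
    refine h2.congr fun j => ?_
    exact (hasSum_norm_sq_coord (x j)).tsum_eq
  obtain ⟨y, hy, hyx⟩ := exists_nat_reindex x hx
  refine ⟨vectorFunctional hy, ⟨y, y, hy, hy, fun T => hasSum_vectorFunctional hy T.1⟩,
    fun α β => (hasSum_vectorFunctional hy _).unique ?_⟩
  refine hyx (fun z => ⟪z, matrixUnit α β z⟫_ℂ) _ (by simp) ?_
  refine (b.hasSum_inner_mul_inner (h α) (h β)).congr_fun fun j => ?_
  rw [matrixUnit_apply, inner_smul_right, inner_fockBasis_right, ← inner_conj_symm (h α),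
    mul_comm]

end gram

/-! ### A summation lemma on words -/

section words

variable {ι : Type*}

/-- Words are empty or have a first letter. -/
def wordEquiv (ι : Type*) : List ι ≃ Unit ⊕ (ι × List ι) where
  toFun
    | [] => .inl ()
    | i :: μ => .inr (i, μ)
  invFun
    | .inl _ => []
    | .inr (i, μ) => i :: μ
  left_inv μ := by cases μ <;> rfl
  right_inv μ := by rcases μ with _ | ⟨i, μ⟩ <;> rfl

theorem tsum_word (f : List ι → ENNReal) :
    ∑' μ, f μ = f [] + ∑' i, ∑' μ, f (i :: μ) := by
  rw [← (wordEquiv ι).symm.tsum_eq f, ENNReal.summable.tsum_sum ENNReal.summable,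
    tsum_fintype, ENNReal.tsum_prod', Finset.univ_unique, Finset.sum_singleton]
  rfl

/-- Here `a` is superharmonic on the tree of words and `p` is bounded by what it loses at each
vertex, so the total loss is at most the value at the root. Working in `ENNReal` removes all
summability questions. -/
theorem tsum_word_le {p a : List ι → ENNReal}
    (h : ∀ μ, p μ + ∑' i, a (μ ++ [i]) ≤ a μ) : ∑' μ, p μ ≤ a [] := by
  -- The bound is proved at every vertex `μ` at once, because splitting off the first letter of `ν`
  -- moves the root from `μ` to `μ ++ [i]`.
  have key : ∀ n : ℕ, ∀ μ, ∑' ν : List ι, (if ν.length < n then p (μ ++ ν) else 0) ≤ a μ := by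
    intro n
    induction n with
    | zero => intro μ; simp
    | succ n ih =>
      intro μ
      rw [tsum_word]
      refine le_trans ?_ (h μ)
      gcongr with i
      · simp
      · simpa using ih (μ ++ [i])
  rw [ENNReal.tsum_eq_iSup_sum]
  refine iSup_le fun s => ?_
  obtain ⟨n, hn⟩ : ∃ n, ∀ ν ∈ s, ν.length < n :=
    ⟨s.sup List.length + 1, fun ν hν => Nat.lt_succ_of_le (Finset.le_sup (f := List.length) hν)⟩
  refine le_trans ?_ (key n [])
  refine le_trans (Finset.sum_le_sum fun ν hν => ?_) (ENNReal.sum_le_tsum s)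
  simp [hn ν hν]

/-- Real form of `tsum_word_le`. -/
theorem summable_word {p a : List ι → ℝ} (hp : ∀ μ, 0 ≤ p μ) (ha : ∀ μ, 0 ≤ a μ)
    (hs : ∀ μ, Summable fun i => a (μ ++ [i]))
    (h : ∀ μ, p μ + ∑' i, a (μ ++ [i]) ≤ a μ) : Summable p := by
  have := tsum_word_le (p := fun μ => ENNReal.ofReal (p μ)) (a := fun μ => ENNReal.ofReal (a μ))
    fun μ => by
      rw [← ENNReal.ofReal_tsum_of_nonneg (fun i => ha _) (hs μ),
        ← ENNReal.ofReal_add (hp μ) (tsum_nonneg fun i => ha _)]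
      exact ENNReal.ofReal_le_ofReal (h μ)
  have h2 := ENNReal.summable_toReal (this.trans_lt ENNReal.ofReal_lt_top).ne
  simpa only [ENNReal.toReal_ofReal (hp _)] using h2

end words

/-! ### Isometric families in the GNS representation -/

section words

variable {ι : Type*} {A : Type*}

theorem word_nil [Monoid A] (v : ι → A) : word v [] = 1 := rfl

theorem word_cons [Monoid A] (v : ι → A) (i : ι) (μ : List ι) :
    word v (i :: μ) = v i * word v μ := by
  simp [word]

theorem word_append [Monoid A] (v : ι → A) (μ ν : List ι) :
    word v (μ ++ ν) = word v μ * word v ν := by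
  simp [word]

theorem word_singleton [Monoid A] (v : ι → A) (i : ι) : word v [i] = v i := by
  simp [word]

variable [CStarAlgebra A] {v : ι → A}

theorem IsIsometricFamily.word (hv : IsIsometricFamily v) (k : ℕ) :
    IsIsometricFamily fun μ : {μ : List ι // μ.length = k} => TC.word v μ := by
  have h1 : ∀ μ : List ι, star (TC.word v μ) * TC.word v μ = 1 := by
    intro μ
    induction μ with
    | nil => simp [word_nil]
    | cons i μ ih =>
      rw [word_cons, star_mul, mul_assoc, ← mul_assoc (star (v i)), hv.1, one_mul, ih]
  have h2 : ∀ μ ν : List ι, μ.length = ν.length → μ ≠ ν →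
      star (TC.word v μ) * TC.word v ν = 0 := by
    intro μ
    induction μ with
    | nil =>
      intro ν hl hne
      exact absurd (List.length_eq_zero_iff.1 hl.symm).symm hne
    | cons i μ ih =>
      intro ν hl hne
      rcases ν with _ | ⟨j, ν⟩
      · simp at hl
      rw [word_cons, word_cons, star_mul, mul_assoc, ← mul_assoc (star (v i))]
      by_cases hij : i = j
      · subst hij
        rw [hv.1, one_mul]
        exact ih ν (by simpa using hl) (by simpa using hne)
      · rw [hv.2 i j hij, zero_mul, mul_zero]
  exact ⟨fun μ => h1 μ, fun μ ν h => h2 μ ν (μ.2.trans ν.2.symm) fun h' => h (Subtype.ext h')⟩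

end words

section gns

variable {ι : Type*} {A : Type*} [CStarAlgebra A] [PartialOrder A] [StarOrderedRing A]
  {v : ι → A}

/-- The vector of the GNS space given by an element of the algebra. -/
noncomputable def gnsVec (σ : A →ₚ[ℂ] ℂ) (a : A) : σ.GNS := (σ.toPreGNS a : σ.GNS)

theorem gnsStarAlgHom_gnsVec (σ : A →ₚ[ℂ] ℂ) (a b : A) :
    σ.gnsStarAlgHom a (gnsVec σ b) = gnsVec σ (a * b) := by
  simp [gnsVec]

theorem inner_gnsVec (σ : A →ₚ[ℂ] ℂ) (a b : A) :
    ⟪gnsVec σ a, gnsVec σ b⟫_ℂ = σ (star a * b) := by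
  rw [gnsVec, gnsVec, UniformSpace.Completion.inner_coe, PositiveLinearMap.preGNS_inner_def]
  rfl

theorem continuous_gnsVec (σ : A →ₚ[ℂ] ℂ) : Continuous (gnsVec σ) := by
  have h : Continuous fun a => σ.gnsStarAlgHom a (gnsVec σ 1) :=
    (ContinuousLinearMap.apply ℂ σ.GNS (gnsVec σ 1)).continuous.comp
      (map_continuous σ.gnsStarAlgHom)
  simpa only [gnsStarAlgHom_gnsVec, mul_one] using h

theorem denseRange_gnsVec (σ : A →ₚ[ℂ] ℂ) : DenseRange (gnsVec σ) :=
  UniformSpace.Completion.denseRange_coe.comp σ.toPreGNS.surjective.denseRange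
    (UniformSpace.Completion.continuous_coe _)

/-- The isometries `π(vᵢ)` of the GNS space. -/
noncomputable def gnsIsometry (hv : IsIsometricFamily v) (σ : A →ₚ[ℂ] ℂ) (i : ι) :
    σ.GNS →ₗᵢ[ℂ] σ.GNS where
  toLinearMap := (σ.gnsStarAlgHom (v i)).toLinearMap
  norm_map' x := by
    have h : ContinuousLinearMap.adjoint (σ.gnsStarAlgHom (v i)) (σ.gnsStarAlgHom (v i) x) = x := by
      rw [← ContinuousLinearMap.star_eq_adjoint, ← map_star, ← mul_apply_eq_comp, ← map_mul,
        hv.1, map_one]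
      rfl
    have h2 := ContinuousLinearMap.adjoint_inner_right (σ.gnsStarAlgHom (v i)) x
      (σ.gnsStarAlgHom (v i) x)
    rw [h, inner_self_eq_norm_sq_to_K, inner_self_eq_norm_sq_to_K] at h2
    have h3 : ‖x‖ ^ 2 = ‖σ.gnsStarAlgHom (v i) x‖ ^ 2 := Complex.ofReal_injective (by
      rw [Complex.ofReal_pow, Complex.ofReal_pow]; exact h2)
    exact ((sq_eq_sq₀ (norm_nonneg _) (norm_nonneg _)).1 h3).symm

theorem gnsIsometry_apply (hv : IsIsometricFamily v) (σ : A →ₚ[ℂ] ℂ) (i : ι) (x : σ.GNS) :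
    gnsIsometry hv σ i x = σ.gnsStarAlgHom (v i) x := rfl

theorem adj_gnsIsometry (hv : IsIsometricFamily v) (σ : A →ₚ[ℂ] ℂ) (i : ι) :
    adj (gnsIsometry hv σ i) = σ.gnsStarAlgHom (star (v i)) := by
  rw [map_star, ContinuousLinearMap.star_eq_adjoint]
  rfl

theorem gnsIsometry_orthogonalFamily (hv : IsIsometricFamily v) (σ : A →ₚ[ℂ] ℂ) :
    OrthogonalFamily ℂ (fun _ : ι => σ.GNS) (gnsIsometry hv σ) := by
  intro i j hij x y
  rw [gnsIsometry_apply, gnsIsometry_apply, ← ContinuousLinearMap.adjoint_inner_right,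
    ← ContinuousLinearMap.star_eq_adjoint, ← map_star, ← mul_apply_eq_comp, ← map_mul,
    hv.2 i j hij, map_zero]
  simp

/-- The endomorphism `T ↦ ∑ᵢ π(vᵢ) T π(vᵢ)*` of the bounded operators on the GNS space. -/
noncomputable def gnsEndo (hv : IsIsometricFamily v) (σ : A →ₚ[ℂ] ℂ) :
    (σ.GNS →L[ℂ] σ.GNS) →⋆ₙₐ[ℂ] (σ.GNS →L[ℂ] σ.GNS) :=
  endo (gnsIsometry_orthogonalFamily hv σ)

theorem hasSum_gnsEndo (hv : IsIsometricFamily v) (σ : A →ₚ[ℂ] ℂ) (T : σ.GNS →L[ℂ] σ.GNS)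
    (x : σ.GNS) : HasSum (fun i => σ.gnsStarAlgHom (v i) (T (σ.gnsStarAlgHom (star (v i)) x)))
      (gnsEndo hv σ T x) := by
  have := hasSum_endoFun (gnsIsometry_orthogonalFamily hv σ) T x
  simp only [adj_gnsIsometry, gnsIsometry_apply] at this
  exact this

theorem star_gnsEndo (hv : IsIsometricFamily v) (σ : A →ₚ[ℂ] ℂ) (T : σ.GNS →L[ℂ] σ.GNS)
    (x : σ.GNS) (i : ι) : σ.gnsStarAlgHom (star (v i)) (gnsEndo hv σ T x) =
      T (σ.gnsStarAlgHom (star (v i)) x) := by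
  have := adjoint_endoFun (gnsIsometry_orthogonalFamily hv σ) T x i
  rwa [adj_gnsIsometry] at this

/-- Only the `i`-th term of the defining sum survives, since `v_j* v_i` vanishes for `j ≠ i`.
Together with `star_gnsEndo` this shifts the level of `rangeProj` by one across `π(vᵢ)` and
`π(vᵢ)*`. -/
theorem gnsEndo_gen (hv : IsIsometricFamily v) (σ : A →ₚ[ℂ] ℂ) (T : σ.GNS →L[ℂ] σ.GNS)
    (x : σ.GNS) (i : ι) : gnsEndo hv σ T (σ.gnsStarAlgHom (v i) x) =
      σ.gnsStarAlgHom (v i) (T x) := by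
  refine (hasSum_gnsEndo hv σ T _).unique ?_
  have e : ∀ j, σ.gnsStarAlgHom (star (v j)) (σ.gnsStarAlgHom (v i) x) =
      σ.gnsStarAlgHom (star (v j) * v i) x := fun j => by rw [map_mul]; rfl
  convert hasSum_single i ?_ using 1
  · rw [e, hv.1, map_one]; rfl
  · intro j hj
    rw [e, hv.2 j i hj, map_zero]
    simp

/-- The projection `∑_{|μ|=k} π(v_μ v_μ*)` of the GNS space. -/
noncomputable def rangeProj (hv : IsIsometricFamily v) (σ : A →ₚ[ℂ] ℂ) (k : ℕ) :
    σ.GNS →L[ℂ] σ.GNS := (gnsEndo hv σ)^[k] 1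

theorem rangeProj_zero (hv : IsIsometricFamily v) (σ : A →ₚ[ℂ] ℂ) : rangeProj hv σ 0 = 1 := rfl

theorem rangeProj_succ (hv : IsIsometricFamily v) (σ : A →ₚ[ℂ] ℂ) (k : ℕ) :
    rangeProj hv σ (k + 1) = gnsEndo hv σ (rangeProj hv σ k) :=
  Function.iterate_succ_apply' _ _ _

theorem star_rangeProj (hv : IsIsometricFamily v) (σ : A →ₚ[ℂ] ℂ) (k : ℕ) :
    star (rangeProj hv σ k) = rangeProj hv σ k := by
  induction k with
  | zero => simp [rangeProj_zero]
  | succ k ih => rw [rangeProj_succ, ← map_star, ih]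

theorem rangeProj_mul_self (hv : IsIsometricFamily v) (σ : A →ₚ[ℂ] ℂ) (k : ℕ) :
    rangeProj hv σ k * rangeProj hv σ k = rangeProj hv σ k := by
  induction k with
  | zero => simp [rangeProj_zero]
  | succ k ih => rw [rangeProj_succ, ← map_mul, ih]

theorem inner_rangeProj (hv : IsIsometricFamily v) (σ : A →ₚ[ℂ] ℂ) (k : ℕ) (x y : σ.GNS) :
    ⟪rangeProj hv σ k x, rangeProj hv σ k y⟫_ℂ = ⟪x, rangeProj hv σ k y⟫_ℂ := by
  rw [← ContinuousLinearMap.adjoint_inner_right, ← ContinuousLinearMap.star_eq_adjoint,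
    star_rangeProj, ← mul_apply_eq_comp, rangeProj_mul_self]

theorem norm_rangeProj_apply_le (hv : IsIsometricFamily v) (σ : A →ₚ[ℂ] ℂ) (k : ℕ) (x : σ.GNS) :
    ‖rangeProj hv σ k x‖ ≤ ‖x‖ := by
  induction k generalizing x with
  | zero => rfl
  | succ k ih =>
    rw [rangeProj_succ]
    have h1 : ‖rangeProj hv σ k‖ ≤ 1 := ContinuousLinearMap.opNorm_le_bound _ zero_le_one
      fun x => by rw [one_mul]; exact ih x
    have h2 := norm_endo_le (gnsIsometry_orthogonalFamily hv σ) (rangeProj hv σ k) x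
    exact h2.trans (mul_le_of_le_one_left (norm_nonneg _) h1)

theorem hasSum_rangeProj (hv : IsIsometricFamily v) (σ : A →ₚ[ℂ] ℂ) (k : ℕ) (x : σ.GNS) :
    HasSum (fun μ : {μ : List ι // μ.length = k} =>
      σ.gnsStarAlgHom (word v μ * star (word v μ)) x) (rangeProj hv σ k x) := by
  -- The words of length `k` are themselves isometries with orthogonal ranges, so convergence is
  -- known beforehand; the induction only has to identify the sum, splitting off the first letter.
  have hs : ∀ k x, Summable (fun μ : {μ : List ι // μ.length = k} =>
      σ.gnsStarAlgHom (word v μ * star (word v μ)) x) := by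
    intro k x
    have := (hasSum_gnsEndo (hv.word k) σ 1 x).summable
    refine this.congr fun μ => ?_
    rw [map_mul]
    rfl
  induction k generalizing x with
  | zero =>
    rw [rangeProj_zero]
    convert hasSum_single (⟨[], rfl⟩ : {μ : List ι // μ.length = 0}) ?_ using 1
    · simp [word_nil]
    · rintro ⟨μ, hμ⟩ h
      exact absurd (Subtype.ext (List.length_eq_zero_iff.1 hμ)) h
  | succ k ih =>
    let e : ι × {μ : List ι // μ.length = k} ≃ {μ : List ι // μ.length = k + 1} :=
      { toFun := fun p => ⟨p.1 :: p.2.1, by simp [p.2.2]⟩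
        invFun := fun μ => match μ with
          | ⟨i :: μ, h⟩ => (i, ⟨μ, by simpa using h⟩)
        left_inv := fun _ => rfl
        right_inv := fun μ => match μ with
          | ⟨i :: μ, h⟩ => rfl }
    have h1 := e.hasSum_iff.2 (hs (k + 1) x).hasSum
    have h2 := h1.prod_fiberwise (g := fun i =>
      σ.gnsStarAlgHom (v i) (rangeProj hv σ k (σ.gnsStarAlgHom (star (v i)) x))) fun i => by
        refine ((ih (σ.gnsStarAlgHom (star (v i)) x)).mapL (σ.gnsStarAlgHom (v i))).congr_fun
          fun μ => ?_
        change σ.gnsStarAlgHom (word v (i :: μ.1) * star (word v (i :: μ.1))) x = _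
        rw [word_cons, star_mul, ← mul_assoc, mul_assoc (v i), map_mul, map_mul]
        rfl
    have h3 := h2.unique (hasSum_gnsEndo hv σ (rangeProj hv σ k) x)
    rw [rangeProj_succ, ← h3]
    exact (hs (k + 1) x).hasSum

/-- The vectors `π(v_μ)* ξ`, where `ξ` is the cyclic vector. -/
noncomputable def cyclicWord (v : ι → A) (σ : A →ₚ[ℂ] ℂ) (μ : List ι) : σ.GNS :=
  gnsVec σ (star (word v μ))

theorem inner_cyclicWord (σ : A →ₚ[ℂ] ℂ) (α β : List ι) :
    ⟪cyclicWord v σ α, cyclicWord v σ β⟫_ℂ = σ (word v α * star (word v β)) := by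
  rw [cyclicWord, cyclicWord, inner_gnsVec, star_star]

theorem star_cyclicWord (σ : A →ₚ[ℂ] ℂ) (μ : List ι) (i : ι) :
    σ.gnsStarAlgHom (star (v i)) (cyclicWord v σ μ) = cyclicWord v σ (μ ++ [i]) := by
  rw [cyclicWord, cyclicWord, gnsStarAlgHom_gnsVec, word_append, star_mul, word_singleton]

theorem hasSum_inner_gnsEndo (hv : IsIsometricFamily v) (σ : A →ₚ[ℂ] ℂ)
    (T : σ.GNS →L[ℂ] σ.GNS) (α β : List ι) :
    HasSum (fun i => ⟪cyclicWord v σ (α ++ [i]), T (cyclicWord v σ (β ++ [i]))⟫_ℂ)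
      ⟪cyclicWord v σ α, gnsEndo hv σ T (cyclicWord v σ β)⟫_ℂ := by
  refine ((hasSum_gnsEndo hv σ T (cyclicWord v σ β)).mapL
    (innerSL ℂ (cyclicWord v σ α))).congr_fun fun i => ?_
  have h := ContinuousLinearMap.adjoint_inner_left (σ.gnsStarAlgHom (v i))
    (T (σ.gnsStarAlgHom (star (v i)) (cyclicWord v σ β))) (cyclicWord v σ α)
  rw [← ContinuousLinearMap.star_eq_adjoint, ← map_star, star_cyclicWord, star_cyclicWord] at h
  rw [h, innerSL_apply_apply, star_cyclicWord]

/-- The matrix of moments `⟨π(v_α)* ξ, ∑_{|μ|=k} π(v_μ v_μ*) π(v_β)* ξ⟩`. -/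
noncomputable def moment (hv : IsIsometricFamily v) (σ : A →ₚ[ℂ] ℂ) (k : ℕ) (α β : List ι) : ℂ :=
  ⟪cyclicWord v σ α, rangeProj hv σ k (cyclicWord v σ β)⟫_ℂ

theorem moment_zero (hv : IsIsometricFamily v) (σ : A →ₚ[ℂ] ℂ) (α β : List ι) :
    moment hv σ 0 α β = σ (word v α * star (word v β)) := inner_cyclicWord σ α β

theorem hasSum_moment (hv : IsIsometricFamily v) (σ : A →ₚ[ℂ] ℂ) (k : ℕ) (α β : List ι) :
    HasSum (fun i => moment hv σ k (α ++ [i]) (β ++ [i])) (moment hv σ (k + 1) α β) := by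
  rw [moment, rangeProj_succ]
  exact hasSum_inner_gnsEndo hv σ _ α β

/-- The three functionals have different GNS spaces, so the operators cannot be compared. The
recursion `hasSum_moment` expresses every moment through values of the functional itself, which are
additive. -/
theorem moment_add (hv : IsIsometricFamily v) (σ τ : A →ₚ[ℂ] ℂ) (k : ℕ) (α β : List ι) :
    moment hv (σ + τ) k α β = moment hv σ k α β + moment hv τ k α β := by
  induction k generalizing α β with
  | zero => simp only [moment_zero]; rfl
  | succ k ih =>
    refine (hasSum_moment hv (σ + τ) k α β).unique ?_
    simp only [ih]
    exact (hasSum_moment hv σ k α β).add (hasSum_moment hv τ k α β)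

theorem norm_sq_rangeProj (hv : IsIsometricFamily v) (σ : A →ₚ[ℂ] ℂ) (k : ℕ) (α : List ι) :
    moment hv σ k α α = ((‖rangeProj hv σ k (cyclicWord v σ α)‖ ^ 2 : ℝ) : ℂ) := by
  rw [moment, ← inner_rangeProj, inner_self_eq_norm_sq_to_K, Complex.ofReal_pow]
  rfl

end gns

/-! ### The functional `ω` -/

section support

variable {ι : Type u}

theorem beta_mem_supp {k : ℕ} {T : FockOp ι} (hT : T ∈ supp ι k) : beta ι T ∈ supp ι (k + 1) := by
  have h2 : beta ι (proj ι k) * proj ι (k + 1) = beta ι (proj ι k) := by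
    have := congrArg star (proj_mul_beta_proj ι k)
    rwa [star_mul, ← map_star, star_proj, star_proj] at this
  refine mem_supp_of ?_ ?_
  · conv_rhs => rw [← left_of_mem_supp hT, map_mul]
    conv_lhs => rw [← left_of_mem_supp hT, map_mul, ← mul_assoc, proj_mul_beta_proj]
  · conv_rhs => rw [← right_of_mem_supp hT, map_mul]
    conv_lhs => rw [← right_of_mem_supp hT, map_mul, mul_assoc, h2]

theorem iterate_beta_mem_supp {k : ℕ} {T : FockOp ι} (hT : T ∈ supp ι k) (i : ℕ) :
    (beta ι)^[i] T ∈ supp ι (k + i) := by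
  induction i with
  | zero => exact hT
  | succ i ih => rw [Function.iterate_succ_apply']; exact beta_mem_supp ih

/-- Compression to `P_k` as a linear map. -/
noncomputable def compress (k : ℕ) : FockOp ι →ₗ[ℂ] FockOp ι :=
  LinearMap.mulRight ℂ (proj ι k) ∘ₗ LinearMap.mulLeft ℂ (proj ι k)

theorem compress_apply (k : ℕ) (T : FockOp ι) : compress k T = proj ι k * T * proj ι k := rfl

theorem compress_of_mem {k : ℕ} {T : FockOp ι} (h : T ∈ supp ι k) : compress k T = T := h.symm

/-- `β` as a linear map. -/
noncomputable def betaL (ι : Type u) : FockOp ι →ₗ[ℂ] FockOp ι where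
  toFun := beta ι
  map_add' := map_add _
  map_smul' := map_smul _

/-- The iterates of `β` as linear maps. -/
noncomputable def iterBetaL (ι : Type u) (i : ℕ) : FockOp ι →ₗ[ℂ] FockOp ι where
  toFun := (beta ι)^[i]
  map_add' := iterate_map_add (beta ι) i
  map_smul' c T := iterate_beta_smul c T i

end support

section functional

variable {ι : Type u} {A : Type v} [CStarAlgebra A] [PartialOrder A] [StarOrderedRing A]
  {v : ι → A}

/-- Since `π(vᵢ)* h_μ = h_{μi}`, this is Pythagoras for the orthogonal expansion of `Q_1 h_μ`. -/
theorem hasSum_norm_sq_cyclicWord (hv : IsIsometricFamily v) (σ : A →ₚ[ℂ] ℂ) (μ : List ι) :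
    HasSum (fun i => ‖cyclicWord v σ (μ ++ [i])‖ ^ 2)
      (‖rangeProj hv σ 1 (cyclicWord v σ μ)‖ ^ 2) := by
  have h : HasSum (fun i => gnsIsometry hv σ i (cyclicWord v σ (μ ++ [i])))
      (rangeProj hv σ 1 (cyclicWord v σ μ)) := by
    refine (hasSum_gnsEndo hv σ 1 (cyclicWord v σ μ)).congr_fun fun i => ?_
    rw [star_cyclicWord]
    rfl
  exact hasSum_norm_sq_of_orthogonalFamily (gnsIsometry_orthogonalFamily hv σ) h

/-- The vectors `π(v_μ)* ξ` cut off at length `N`. -/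
noncomputable def truncWord (v : ι → A) (σ : A →ₚ[ℂ] ℂ) (N : ℕ) (μ : List ι) : σ.GNS :=
  if μ.length ≤ N then cyclicWord v σ μ else 0

/-- The weight `N + 1 - |μ|` drops by one with each letter, which releases one copy of `‖h_μ‖²` at
every word of length at most `N`. Truncated subtraction makes it zero beyond length `N`. -/
theorem summable_truncWord (hv : IsIsometricFamily v) (σ : A →ₚ[ℂ] ℂ) (N : ℕ) :
    Summable fun μ => ‖truncWord v σ N μ‖ ^ 2 := by
  refine summable_word
    (a := fun μ => ((N + 1 - μ.length : ℕ) : ℝ) * ‖cyclicWord v σ μ‖ ^ 2)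
    (fun μ => by positivity) (fun μ => by positivity) (fun μ => ?_) fun μ => ?_
  · simpa using (hasSum_norm_sq_cyclicWord hv σ μ).summable.mul_left _
  · simp only [List.length_append, List.length_singleton]
    rw [tsum_mul_left, (hasSum_norm_sq_cyclicWord hv σ μ).tsum_eq]
    have h := norm_rangeProj_apply_le hv σ 1 (cyclicWord v σ μ)
    have h2 : ‖rangeProj hv σ 1 (cyclicWord v σ μ)‖ ^ 2 ≤ ‖cyclicWord v σ μ‖ ^ 2 := by gcongr
    unfold truncWord
    split_ifs with hN
    · have e : ((N + 1 - μ.length : ℕ) : ℝ) = ((N + 1 - (μ.length + 1) : ℕ) : ℝ) + 1 := by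
        rw [show N + 1 - μ.length = N + 1 - (μ.length + 1) + 1 by omega]
        push_cast
        rfl
      rw [e]
      nlinarith [Nat.cast_nonneg (α := ℝ) (N + 1 - (μ.length + 1))]
    · have e1 : N + 1 - (μ.length + 1) = 0 := by omega
      have e2 : N + 1 - μ.length = 0 := by omega
      simp [e1, e2]

/-- The defect vectors `(1 - ∑ᵢ π(vᵢ vᵢ*)) π(v_μ)* ξ`. -/
noncomputable def defectWord (hv : IsIsometricFamily v) (σ : A →ₚ[ℂ] ℂ) (μ : List ι) : σ.GNS :=
  cyclicWord v σ μ - rangeProj hv σ 1 (cyclicWord v σ μ)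

theorem inner_defectWord (hv : IsIsometricFamily v) (σ : A →ₚ[ℂ] ℂ) (α β : List ι) :
    ⟪defectWord hv σ α, defectWord hv σ β⟫_ℂ = moment hv σ 0 α β - moment hv σ 1 α β := by
  have h1 := inner_rangeProj hv σ 1 (cyclicWord v σ α) (cyclicWord v σ β)
  have h2 : ⟪rangeProj hv σ 1 (cyclicWord v σ α), cyclicWord v σ β⟫_ℂ =
      ⟪cyclicWord v σ α, rangeProj hv σ 1 (cyclicWord v σ β)⟫_ℂ := by
    rw [← ContinuousLinearMap.adjoint_inner_right, ← ContinuousLinearMap.star_eq_adjoint,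
      star_rangeProj]
  rw [defectWord, defectWord, inner_sub_left, inner_sub_right, inner_sub_right, h1, h2, moment,
    moment, rangeProj_zero]
  simp

theorem norm_sq_defectWord (hv : IsIsometricFamily v) (σ : A →ₚ[ℂ] ℂ) (μ : List ι) :
    ‖defectWord hv σ μ‖ ^ 2 =
      ‖cyclicWord v σ μ‖ ^ 2 - ‖rangeProj hv σ 1 (cyclicWord v σ μ)‖ ^ 2 := by
  have h := inner_defectWord hv σ μ μ
  rw [norm_sq_rangeProj, norm_sq_rangeProj, inner_self_eq_norm_sq_to_K, rangeProj_zero] at h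
  refine Complex.ofReal_injective ?_
  rw [Complex.ofReal_sub, Complex.ofReal_pow]
  exact h

/-- The squared norm of the defect is exactly the loss `‖h_μ‖² - ∑ᵢ ‖h_{μi}‖²`, so no length cut-off
is needed. This is why `ω ∘ δ` is globally normal while `ω` is only locally so. -/
theorem summable_defectWord (hv : IsIsometricFamily v) (σ : A →ₚ[ℂ] ℂ) :
    Summable fun μ => ‖defectWord hv σ μ‖ ^ 2 := by
  refine summable_word (a := fun μ => ‖cyclicWord v σ μ‖ ^ 2)
    (fun μ => by positivity) (fun μ => by positivity)
    (fun μ => (hasSum_norm_sq_cyclicWord hv σ μ).summable) fun μ => ?_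
  rw [(hasSum_norm_sq_cyclicWord hv σ μ).tsum_eq, norm_sq_defectWord]
  linarith

/-- The restriction of `ω` to `𝔅_N`, extended to all operators by compression. -/
noncomputable def levelFun (hv : IsIsometricFamily v) (σ : A →ₚ[ℂ] ℂ) (N : ℕ) :
    FockOp ι →ₚ[ℂ] ℂ :=
  (exists_normal_of_gram _ (summable_truncWord hv σ N)).choose

theorem levelFun_normal (hv : IsIsometricFamily v) (σ : A →ₚ[ℂ] ℂ) (N : ℕ) :
    IsNormalOn (Set.univ : Set (FockOp ι)) fun T => levelFun hv σ N T.1 :=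
  (exists_normal_of_gram _ (summable_truncWord hv σ N)).choose_spec.1

theorem levelFun_matrixUnit (hv : IsIsometricFamily v) (σ : A →ₚ[ℂ] ℂ) (N : ℕ) (α β : List ι) :
    levelFun hv σ N (matrixUnit α β) =
      if α.length ≤ N ∧ β.length ≤ N then moment hv σ 0 α β else 0 := by
  refine ((exists_normal_of_gram _ (summable_truncWord hv σ N)).choose_spec.2 α β).trans ?_
  unfold truncWord
  by_cases h1 : α.length ≤ N <;> by_cases h2 : β.length ≤ N <;>
    simp [h1, h2, moment, rangeProj_zero]

/-- The normal functional extending `ω ∘ δ`. -/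
noncomputable def defectFun (hv : IsIsometricFamily v) (σ : A →ₚ[ℂ] ℂ) : FockOp ι →ₚ[ℂ] ℂ :=
  (exists_normal_of_gram _ (summable_defectWord hv σ)).choose

theorem defectFun_normal (hv : IsIsometricFamily v) (σ : A →ₚ[ℂ] ℂ) :
    IsNormalOn (Set.univ : Set (FockOp ι)) fun T => defectFun hv σ T.1 :=
  (exists_normal_of_gram _ (summable_defectWord hv σ)).choose_spec.1

theorem defectFun_matrixUnit (hv : IsIsometricFamily v) (σ : A →ₚ[ℂ] ℂ) (α β : List ι) :
    defectFun hv σ (matrixUnit α β) = moment hv σ 0 α β - moment hv σ 1 α β :=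
  ((exists_normal_of_gram _ (summable_defectWord hv σ)).choose_spec.2 α β).trans
    (inner_defectWord hv σ α β)

/-- Both sides are normal and agree on matrix units. This compatibility of the levels makes them
glue to one functional on `𝔅`. -/
theorem levelFun_compress (hv : IsIsometricFamily v) (σ : A →ₚ[ℂ] ℂ) {k m : ℕ} (h : k ≤ m)
    (T : FockOp ι) : levelFun hv σ m (compress k T) = levelFun hv σ k T := by
  refine LinearMap.congr_fun (f := (levelFun hv σ m).toLinearMap ∘ₗ compress k)
    (g := (levelFun hv σ k).toLinearMap) (eq_of_matrixUnit (fun T => ?_) (fun T => ?_)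
      fun α β => ?_) T
  · exact (levelFun_normal hv σ m).tendsto_univ ((bStrong_coordProj T).mul_mul _ _)
  · exact (levelFun_normal hv σ k).tendsto_univ (bStrong_coordProj T)
  · change levelFun hv σ m (compress k (matrixUnit α β)) = levelFun hv σ k (matrixUnit α β)
    rw [compress_apply, compress_matrixUnit, levelFun_matrixUnit]
    split_ifs with h1
    · rw [levelFun_matrixUnit, if_pos ⟨h1.1.trans h, h1.2.trans h⟩]
    · exact map_zero _

theorem levelFun_eq_of_mem (hv : IsIsometricFamily v) (σ : A →ₚ[ℂ] ℂ) {k m : ℕ}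
    {T : FockOp ι} (hk : T ∈ supp ι k) (hm : T ∈ supp ι m) :
    levelFun hv σ k T = levelFun hv σ m T := by
  rw [← levelFun_compress hv σ (le_max_left k m), ← levelFun_compress hv σ (le_max_right k m) T,
    compress_of_mem hk, compress_of_mem hm]

/-- The functional `ω` on `𝔅` with `ω(e_α e_β*) = σ(v_α v_β*)`. -/
noncomputable def omegaFun (hv : IsIsometricFamily v) (σ : A →ₚ[ℂ] ℂ) : bddSupp ι →ₗ[ℂ] ℂ where
  toFun B := levelFun hv σ (mem_bddSupp.1 B.2).choose B
  map_add' := fun B C => by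
    obtain ⟨j, hj⟩ := mem_bddSupp.1 B.2
    obtain ⟨k, hk⟩ := mem_bddSupp.1 C.2
    obtain ⟨l, hl⟩ := mem_bddSupp.1 (B + C).2
    have hj' := supp_mono (le_trans (le_max_left j k) (le_max_left _ l)) hj
    have hk' := supp_mono (le_trans (le_max_right j k) (le_max_left _ l)) hk
    have hl' := supp_mono (le_max_right (max j k) l) hl
    rw [levelFun_eq_of_mem hv σ (mem_bddSupp.1 B.2).choose_spec hj',
      levelFun_eq_of_mem hv σ (mem_bddSupp.1 C.2).choose_spec hk',
      levelFun_eq_of_mem hv σ (mem_bddSupp.1 (B + C).2).choose_spec hl', ← map_add]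
    rfl
  map_smul' := fun c B => by
    obtain ⟨j, hj⟩ := mem_bddSupp.1 B.2
    obtain ⟨l, hl⟩ := mem_bddSupp.1 (c • B).2
    have hj' := supp_mono (le_max_left j l) hj
    have hl' := supp_mono (le_max_right j l) hl
    rw [levelFun_eq_of_mem hv σ (mem_bddSupp.1 B.2).choose_spec hj',
      levelFun_eq_of_mem hv σ (mem_bddSupp.1 (c • B).2).choose_spec hl', RingHom.id_apply,
      ← map_smul]
    rfl

theorem omegaFun_eq (hv : IsIsometricFamily v) (σ : A →ₚ[ℂ] ℂ) {k : ℕ} (B : bddSupp ι)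
    (hB : (B : FockOp ι) ∈ supp ι k) : omegaFun hv σ B = levelFun hv σ k B :=
  levelFun_eq_of_mem hv σ (mem_bddSupp.1 B.2).choose_spec hB

theorem omegaFun_matrixUnit (hv : IsIsometricFamily v) (σ : A →ₚ[ℂ] ℂ) (α β : List ι) :
    omegaFun hv σ ⟨matrixUnit α β, matrixUnit_mem_bddSupp α β⟩ =
      σ (word v α * star (word v β)) := by
  rw [omegaFun_eq hv σ _ (matrixUnit_mem_supp (le_max_left _ _) (le_max_right _ _)),
    levelFun_matrixUnit, if_pos ⟨le_max_left _ _, le_max_right _ _⟩, moment_zero]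

theorem IsNormalOn.hasSum_beta {f : FockOp ι →ₗ[ℂ] ℂ}
    (hf : IsNormalOn (Set.univ : Set (FockOp ι)) fun T => f T.1) (i : ℕ) (α β : List ι) :
    HasSum (fun j => f ((beta ι)^[i] (matrixUnit (α ++ [j]) (β ++ [j]))))
      (f ((beta ι)^[i] (beta ι (matrixUnit α β)))) := by
  refine (hf.tendsto_univ ((bStrong_betaPartial (matrixUnit α β)).iterate_beta i)).congr
    fun s => ?_
  have e : ∀ T : FockOp ι, (beta ι)^[i] T = iterBetaL ι i T := fun _ => rfl
  rw [betaPartial_matrixUnit]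
  simp only [e, map_sum]

/-- `ω ∘ δ` is the restriction of a normal positive functional. -/
theorem omegaFun_deltaB (hv : IsIsometricFamily v) (σ : A →ₚ[ℂ] ℂ) (B : bddSupp ι) :
    omegaFun hv σ (deltaB B) = defectFun hv σ B := by
  obtain ⟨k, hk⟩ := mem_bddSupp.1 B.2
  have h1 : (deltaB B : FockOp ι) ∈ supp ι (k + 1) := by
    change (B : FockOp ι) - beta ι B ∈ supp ι (k + 1)
    refine mem_supp_of ?_ ?_
    · rw [mul_sub, left_of_mem_supp (supp_mono k.le_succ hk), left_of_mem_supp (beta_mem_supp hk)]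
    · rw [sub_mul, right_of_mem_supp (supp_mono k.le_succ hk),
        right_of_mem_supp (beta_mem_supp hk)]
  rw [omegaFun_eq hv σ _ h1]
  -- Level `k + 1` is used because `β` raises the length of the support by one. After compression to
  -- `P_k` both sides are continuous for bounded strong convergence, so matrix units suffice; there
  -- `β` becomes the recursion from `m_0` to `m_1`.
  have key : ((levelFun hv σ (k + 1)).toLinearMap ∘ₗ (LinearMap.id - betaL ι)) ∘ₗ compress k =
      (defectFun hv σ).toLinearMap ∘ₗ compress k := by
    refine eq_of_matrixUnit (fun T => ?_) (fun T => ?_) fun α β => ?_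
    · have hb := (bStrong_coordProj T).mul_mul (proj ι k) (proj ι k)
      have := ((levelFun_normal hv σ (k + 1)).tendsto_univ hb).sub
        ((levelFun_normal hv σ (k + 1)).tendsto_univ hb.beta)
      simp only [← map_sub] at this
      exact this
    · exact (defectFun_normal hv σ).tendsto_univ ((bStrong_coordProj T).mul_mul _ _)
    · simp only [LinearMap.comp_apply]
      rw [compress_apply, compress_matrixUnit]
      split_ifs with h
      · have hs := (levelFun_normal hv σ (k + 1)).hasSum_beta
          (f := (levelFun hv σ (k + 1)).toLinearMap) 0 α β
        have hs2 := hasSum_moment hv σ 0 α β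
        have e := hs.unique (hs2.congr_fun fun j => by
          change levelFun hv σ (k + 1) (matrixUnit _ _) = _
          rw [levelFun_matrixUnit, if_pos (by simpa using h)])
        change levelFun hv σ (k + 1) (matrixUnit α β - beta ι (matrixUnit α β)) =
          defectFun hv σ (matrixUnit α β)
        change levelFun hv σ (k + 1) (beta ι (matrixUnit α β)) = _ at e
        rw [map_sub, e, levelFun_matrixUnit, if_pos ⟨h.1.trans k.le_succ, h.2.trans k.le_succ⟩,
          defectFun_matrixUnit]
      · simp only [map_zero]
  have := LinearMap.congr_fun key B
  simp only [LinearMap.comp_apply, compress_of_mem hk] at this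
  exact this

theorem isPos_omegaFun (hv : IsIsometricFamily v) (σ : A →ₚ[ℂ] ℂ) : IsPos (omegaFun hv σ) := by
  intro B
  obtain ⟨k, hk⟩ := mem_bddSupp.1 (star B * B).2
  rw [omegaFun_eq hv σ _ hk]
  exact (levelFun hv σ k).map_nonneg (star_mul_self_nonneg (B : FockOp ι))

theorem isDecreasing_omegaFun (hv : IsIsometricFamily v) (σ : A →ₚ[ℂ] ℂ) :
    IsDecreasing (omegaFun hv σ) := by
  intro B
  rw [omegaFun_deltaB]
  exact (defectFun hv σ).map_nonneg (star_mul_self_nonneg (B : FockOp ι))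

theorem isLocallyNormal_omegaFun (hv : IsIsometricFamily v) (σ : A →ₚ[ℂ] ℂ) :
    IsLocallyNormal (omegaFun hv σ) := by
  intro k
  obtain ⟨ξ, η, hξ, hη, h⟩ := levelFun_normal hv σ k
  refine ⟨ξ, η, hξ, hη, fun T => ?_⟩
  change HasSum _ (omegaFun hv σ ⟨T, mem_bddSupp_of_supp T.2⟩)
  rw [omegaFun_eq hv σ _ T.2]
  exact h ⟨T, Set.mem_univ _⟩

theorem isNormalExtension_defectFun (hv : IsIsometricFamily v) (σ : A →ₚ[ℂ] ℂ) :
    IsNormalExtension (omegaFun hv σ) (defectFun hv σ) :=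
  ⟨defectFun_normal hv σ, fun B => (omegaFun_deltaB hv σ B).symm⟩

end functional

/-! ### The map `λ` -/

section lambda

variable {ι : Type u}

theorem op_ext {S T : FockOp ι} (h : ∀ μ, S (fockBasis μ) = T (fockBasis μ)) : S = T := by
  ext1 x
  have h1 := (hasSum_fockBasis x).mapL S
  have h2 := (hasSum_fockBasis x).mapL T
  refine h1.unique (h2.congr_fun fun μ => ?_)
  rw [map_smul, map_smul, h]

theorem left_right_comm (i j : ι) (x : Fock ι) :
    leftCreation i (rightCreation j x) = rightCreation j (leftCreation i x) := by
  refine DFunLike.congr_fun (op_ext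
    (S := (leftCreation i).toContinuousLinearMap * (rightCreation j).toContinuousLinearMap)
    (T := (rightCreation j).toContinuousLinearMap * (leftCreation i).toContinuousLinearMap)
    fun μ => ?_) x
  change leftCreation i (rightCreation j _) = rightCreation j (leftCreation i _)
  rw [rightCreation_fockBasis, leftCreation_fockBasis, leftCreation_fockBasis,
    rightCreation_fockBasis]
  rfl

theorem beta_left_mul (i : ι) (T : FockOp ι) :
    beta ι ((leftCreation i).toContinuousLinearMap * T) =
      (leftCreation i).toContinuousLinearMap * beta ι T := by
  ext1 x
  refine (hasSum_beta _ x).unique ?_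
  refine ((hasSum_beta T x).mapL (leftCreation i).toContinuousLinearMap).congr_fun fun j => ?_
  exact (left_right_comm i j _).symm

variable {A : Type v} [CStarAlgebra A] {v : ι → A}

theorem fockRep_word_cons (hv : IsToeplitzCuntz v) (i : ι) (μ : List ι) :
    fockRep hv (word v (i :: μ)) =
      (leftCreation i).toContinuousLinearMap * fockRep hv (word v μ) := by
  rw [word_cons, map_mul, fockRep_apply]

theorem beta_fockRep_mul (hv : IsToeplitzCuntz v) (α : List ι) (T : FockOp ι) :
    beta ι (fockRep hv (word v α) * T) = fockRep hv (word v α) * beta ι T := by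
  induction α with
  | nil => simp [word_nil]
  | cons i α ih => rw [fockRep_word_cons, mul_assoc, beta_left_mul, ih, mul_assoc]

theorem beta_mul_star_fockRep (hv : IsToeplitzCuntz v) (β : List ι) (T : FockOp ι) :
    beta ι (T * star (fockRep hv (word v β))) = beta ι T * star (fockRep hv (word v β)) := by
  have := congrArg star (beta_fockRep_mul hv β (star T))
  rwa [← map_star (beta ι), star_mul, star_mul, star_star, ← map_star (beta ι), star_star] at this

theorem iterate_beta_fockRep (hv : IsToeplitzCuntz v) (α β : List ι) (T : FockOp ι) (i : ℕ) :
    (beta ι)^[i] (fockRep hv (word v α) * T * star (fockRep hv (word v β))) =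
      fockRep hv (word v α) * (beta ι)^[i] T * star (fockRep hv (word v β)) := by
  induction i with
  | zero => rfl
  | succ i ih =>
    rw [Function.iterate_succ_apply', ih, beta_mul_star_fockRep, beta_fockRep_mul,
      Function.iterate_succ_apply']

theorem fockRep_word_vacuum (hv : IsToeplitzCuntz v) (α : List ι) :
    fockRep hv (word v α) (fockBasis []) = fockBasis α := by
  induction α with
  | nil => simp [word_nil]
  | cons i α ih =>
    rw [fockRep_word_cons, mul_apply_eq_comp, ih]
    exact leftCreation_fockBasis i α

theorem proj_zero_apply (x : Fock ι) : proj ι 0 x = x [] • fockBasis [] := by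
  refine fock_ext fun μ => ?_
  rw [proj_apply, lp.coeFn_smul, Pi.smul_apply]
  by_cases h : μ = []
  · subst h; simp [fockBasis_apply_self]
  · simp [h, fockBasis_apply_ne h]

theorem matrixUnit_eq (hv : IsToeplitzCuntz v) (α β : List ι) :
    matrixUnit α β =
      fockRep hv (word v α) * proj ι 0 * star (fockRep hv (word v β)) := by
  ext1 x
  rw [matrixUnit_apply, mul_apply_eq_comp, mul_apply_eq_comp, proj_zero_apply, map_smul,
    fockRep_word_vacuum, ← inner_fockBasis_left [], ContinuousLinearMap.star_eq_adjoint,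
    ContinuousLinearMap.adjoint_inner_right, fockRep_word_vacuum, inner_fockBasis_left]

theorem iterate_beta_proj_zero_apply (i : ℕ) (x : Fock ι) (μ : List ι) :
    (beta ι)^[i] (proj ι 0) x μ = if μ.length = i then x μ else 0 := by
  have e : ∀ T : FockOp ι, (beta ι)^[i] T = iterBetaL ι i T := fun _ => rfl
  have h : (beta ι)^[i] (proj ι 0) = (beta ι)^[i] 1 - (beta ι)^[i + 1] 1 := by
    rw [Function.iterate_succ_apply, e, e, e, ← map_sub]
    rfl
  rw [h]
  change (beta ι)^[i] 1 x μ - (beta ι)^[i + 1] 1 x μ = _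
  rw [iterate_beta_one_apply, iterate_beta_one_apply]
  split_ifs <;> first | omega | simp

/-- This says `λ(P_0) = I`: the operator `βⁱ(P_0)` is the projection onto the words of length `i`,
and the expansion of `x` in the basis is grouped by length. -/
theorem hasSum_iterate_beta_proj_zero (x : Fock ι) :
    HasSum (fun i => (beta ι)^[i] (proj ι 0) x) x := by
  have h := (Equiv.sigmaFiberEquiv (List.length : List ι → ℕ)).hasSum_iff.2 (hasSum_fockBasis x)
  refine h.sigma fun i => ?_
  have h2 := hasSum_fockBasis ((beta ι)^[i] (proj ι 0) x)
  rw [← hasSum_subtype_iff_of_support_subset (s := {μ | μ.length = i})] at h2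
  · refine h2.congr_fun fun μ => ?_
    have := iterate_beta_proj_zero_apply i x μ.1
    rw [if_pos (show μ.1.length = i from μ.2)] at this
    change x μ.1 • fockBasis μ.1 = _
    rw [← this]
    rfl
  · intro μ hμ
    by_contra hne
    refine hμ ?_
    change (beta ι)^[i] (proj ι 0) x μ • fockBasis μ = 0
    rw [iterate_beta_proj_zero_apply, if_neg (show ¬ μ.length = i from hne), zero_smul]

/-- `λ(e_α e_β*) = l(v_α v_β*)`. -/
theorem isLambda_matrixUnit (hv : IsToeplitzCuntz v) (α β : List ι) :
    IsLambda (matrixUnit α β) (fockRep hv (word v α * star (word v β))) := by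
  intro x
  rw [matrixUnit_eq hv, map_mul, map_star]
  simp only [iterate_beta_fockRep]
  exact (hasSum_iterate_beta_proj_zero (star (fockRep hv (word v β)) x)).mapL
    (fockRep hv (word v α))

theorem IsLambda.bStrong {B A : FockOp ι} (h : IsLambda B A) :
    BStrong atTop (fun n => ∑ i ∈ Finset.range n, (beta ι)^[i] B) A :=
  BStrong.of_tendsto_nat fun x => by
    have := (h x).tendsto_sum_nat
    simpa using this

theorem IsLambda.tendsto {B A : FockOp ι} (h : IsLambda B A) {f : FockOp ι →ₗ[ℂ] ℂ}
    (hf : IsNormalOn (Set.univ : Set (FockOp ι)) fun T => f T.1) :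
    Tendsto (fun n => ∑ i ∈ Finset.range n, f ((beta ι)^[i] B)) atTop (𝓝 (f A)) := by
  have := hf.tendsto_univ h.bStrong
  simpa only [map_sum] using this

/-- `δ` inverts `λ`. -/
theorem IsLambda.delta_eq {B A : FockOp ι} (h : IsLambda B A) : delta A = B := by
  ext1 x
  have h1 := h.bStrong.2 x
  have h2 := h.bStrong.beta.2 x
  have h3 : Tendsto (fun n => (beta ι)^[n] B x) atTop (𝓝 0) :=
    (h x).summable.tendsto_atTop_zero
  refine tendsto_nhds_unique (h1.sub h2) ?_
  have h4 := (tendsto_const_nhds (x := B x)).sub h3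
  rw [sub_zero] at h4
  refine h4.congr fun n => ?_
  -- The partial sums telescope under `δ`; the remainder `βⁿ(B) x` vanishes as the general term of a
  -- convergent series.
  have key : (∑ i ∈ Finset.range n, (beta ι)^[i] B) -
      beta ι (∑ i ∈ Finset.range n, (beta ι)^[i] B) = B - (beta ι)^[n] B := by
    rw [map_sum, ← Finset.sum_sub_distrib]
    simp only [← Function.iterate_succ_apply']
    exact Finset.sum_range_sub' (fun i => (beta ι)^[i] B) n
  exact (DFunLike.congr_fun key x).symm

end lambda

/-! ### Limits of positive functionals -/

section limit

variable {A : Type*} [CStarAlgebra A] [PartialOrder A] [StarOrderedRing A]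

/-- The bound on the values at `1` confines the values at each `a` to a disc, so limits along a
fixed ultrafilter exist, are linear and positive, and coincide with the ordinary limit wherever
there is one. -/
theorem exists_positive_limit (f : ℕ → A →ₚ[ℂ] ℂ) (c : ℕ → ℝ) (hc : ∀ n, 0 ≤ c n) (C : ℝ)
    (hC : ∀ n, c n * (f n 1).re ≤ C) :
    ∃ D : A →ₚ[ℂ] ℂ, ∀ a z, Tendsto (fun n => c n • f n a) atTop (𝓝 z) → D a = z := by
  have hlim : ∀ a, ∃ z, Tendsto (fun n => c n • f n a) (hyperfilter ℕ : Filter ℕ) (𝓝 z) := by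
    intro a
    obtain ⟨z, -, hz⟩ := (isCompact_closedBall (0 : ℂ) (C * ‖a‖)).ultrafilter_le_nhds
      ((hyperfilter ℕ).map fun n => c n • f n a) (by
        rw [le_principal_iff]
        refine mem_map.2 (Eventually.of_forall fun n => ?_)
        change c n • f n a ∈ Metric.closedBall 0 (C * ‖a‖)
        rw [mem_closedBall_zero_iff, norm_smul, Real.norm_of_nonneg (hc n)]
        calc _ ≤ c n * ((f n 1).re * ‖a‖) := by
              gcongr
              · exact hc n
              · exact norm_apply_le_of_positive (f n) a
          _ = c n * (f n 1).re * ‖a‖ := by ring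
          _ ≤ C * ‖a‖ := by gcongr; exact hC n)
    exact ⟨z, hz⟩
  choose D hD using hlim
  refine ⟨PositiveLinearMap.mk₀
    { toFun := D
      map_add' := fun a b => tendsto_nhds_unique (hD (a + b)) (by
        simpa [smul_add] using (hD a).add (hD b))
      map_smul' := fun r a => tendsto_nhds_unique (hD (r • a)) (by
        simpa [mul_left_comm] using (hD a).const_mul r) } fun a ha => ?_, fun a z h => ?_⟩
  · refine ge_of_tendsto' (hD a) fun n => ?_
    exact smul_nonneg (hc n) ((f n).map_nonneg ha)
  · exact tendsto_nhds_unique (hD a) (h.mono_left Nat.hyperfilter_le_atTop)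

end limit

/-! ### The extension of `ω ∘ δ` to `λ(𝔅)` -/

section support

variable {ι : Type u}

theorem norm_proj_le (k : ℕ) : ‖proj ι k‖ ≤ 1 := by
  have h := CStarRing.norm_star_mul_self (x := proj ι k)
  rw [star_proj, proj_mul_proj ι le_rfl] at h
  by_contra hc
  nlinarith [norm_nonneg (proj ι k)]

theorem norm_compress_le (k : ℕ) (T : FockOp ι) : ‖compress k T‖ ≤ ‖T‖ := by
  have h1 := norm_proj_le (ι := ι) k
  calc _ ≤ ‖proj ι k‖ * ‖T‖ * ‖proj ι k‖ :=
        (norm_mul_le _ _).trans (by gcongr; exact norm_mul_le _ _)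
    _ ≤ 1 * ‖T‖ * 1 := by gcongr
    _ = _ := by ring

theorem iterate_beta_mul_apply (i : ℕ) (S T : FockOp ι) :
    (beta ι)^[i] (S * T) = (beta ι)^[i] S * (beta ι)^[i] T := by
  induction i with
  | zero => rfl
  | succ i ih => simp only [Function.iterate_succ_apply', ih, map_mul]

theorem iterate_beta_proj (i m : ℕ) :
    (beta ι)^[i] (proj ι m) = (beta ι)^[i] 1 - (beta ι)^[i + m + 1] 1 := by
  have e : ∀ T : FockOp ι, (beta ι)^[i] T = iterBetaL ι i T := fun _ => rfl
  rw [proj, add_assoc, Function.iterate_add_apply (beta ι) i (m + 1), e, e, e, ← map_sub]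

/-- Multiplicativity gives `βⁱ(P_m) = P_{i+m} βⁱ(1)`, and `βⁱ(1)` acts as a unit on the range of
`βⁱ`. -/
theorem iterate_beta_compress (i m : ℕ) (T : FockOp ι) :
    (beta ι)^[i] (compress m T) = compress (i + m) ((beta ι)^[i] T) := by
  have h1 : (beta ι)^[i] (proj ι m) = proj ι (i + m) * (beta ι)^[i] 1 := by
    rw [iterate_beta_proj, proj, sub_mul, one_mul, iterate_beta_mul' ι i (i + m + 1) (by omega)]
  have h2 : (beta ι)^[i] (proj ι m) = (beta ι)^[i] 1 * proj ι (i + m) := by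
    rw [iterate_beta_proj, proj, mul_sub, mul_one, iterate_beta_mul ι i (i + m + 1) (by omega)]
  have h3 : (beta ι)^[i] T = (beta ι)^[i] 1 * (beta ι)^[i] T * (beta ι)^[i] 1 := by
    rw [← iterate_beta_mul_apply, ← iterate_beta_mul_apply, one_mul, mul_one]
  calc (beta ι)^[i] (compress m T)
      = (beta ι)^[i] (proj ι m) * (beta ι)^[i] T * (beta ι)^[i] (proj ι m) := by
        rw [compress_apply, iterate_beta_mul_apply, iterate_beta_mul_apply]
    _ = (proj ι (i + m) * (beta ι)^[i] 1) * (beta ι)^[i] T *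
          ((beta ι)^[i] 1 * proj ι (i + m)) := by rw [← h1, ← h2]
    _ = proj ι (i + m) * ((beta ι)^[i] 1 * (beta ι)^[i] T * (beta ι)^[i] 1) *
          proj ι (i + m) := by simp only [mul_assoc]
    _ = _ := by rw [← h3]; rfl

theorem compress_iterate_beta_eq_zero {N i : ℕ} (h : N < i) (T : FockOp ι) :
    compress N ((beta ι)^[i] T) = 0 := by
  have h1 : proj ι N * (beta ι)^[i] 1 = 0 := by
    rw [proj, sub_mul, one_mul, iterate_beta_mul ι (N + 1) i h, sub_self]
  rw [compress_apply, ← one_mul T, iterate_beta_mul_apply, ← mul_assoc, h1, zero_mul, zero_mul]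

/-- `β` as a map of `𝔅` into itself. -/
noncomputable def betaB (B : bddSupp ι) : bddSupp ι := ⟨beta ι B, beta_mem_bddSupp B.2⟩

theorem coe_iterate_betaB (i : ℕ) (B : bddSupp ι) :
    ((betaB^[i] B : bddSupp ι) : FockOp ι) = (beta ι)^[i] B := by
  induction i with
  | zero => rfl
  | succ i ih => rw [Function.iterate_succ_apply', Function.iterate_succ_apply', ← ih]; rfl

theorem deltaB_eq (B : bddSupp ι) : deltaB B = B - betaB B := rfl

theorem beta_nonneg {T : FockOp ι} (h : 0 ≤ T) : 0 ≤ beta ι T := map_nonneg (beta ι) h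

theorem iterate_beta_nonneg {T : FockOp ι} (h : 0 ≤ T) (i : ℕ) : 0 ≤ (beta ι)^[i] T := by
  induction i with
  | zero => exact h
  | succ i ih => rw [Function.iterate_succ_apply']; exact beta_nonneg ih

theorem compress_nonneg {T : FockOp ι} (h : 0 ≤ T) (k : ℕ) : 0 ≤ compress k T := by
  have := star_right_conjugate_nonneg h (proj ι k)
  rwa [star_proj] at this

end support

-- Uniform bounds, means and the essential functional.

section functional

variable {ι : Type u} {A : Type v} [CStarAlgebra A] [PartialOrder A] [StarOrderedRing A]
  {v : ι → A}

theorem omegaFun_sub_betaB (hv : IsIsometricFamily v) (σ : A →ₚ[ℂ] ℂ) (B : bddSupp ι) :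
    omegaFun hv σ B - omegaFun hv σ (betaB B) = defectFun hv σ B := by
  rw [← omegaFun_deltaB, deltaB_eq, map_sub]

theorem omegaFun_iterate_eq (hv : IsIsometricFamily v) (σ : A →ₚ[ℂ] ℂ) {k i m : ℕ}
    {B : bddSupp ι} (hB : (B : FockOp ι) ∈ supp ι k) (h : k + i ≤ m) :
    omegaFun hv σ (betaB^[i] B) = levelFun hv σ m ((beta ι)^[i] B) := by
  rw [omegaFun_eq hv σ (k := m) _ (by
    rw [coe_iterate_betaB]; exact supp_mono h (iterate_beta_mem_supp hB i)), coe_iterate_betaB]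

/-- The bound is uniform in `i`. The functional `T ↦ ω(βⁱ(P_k T P_k))` is positive, hence bounded by
its value `ω(βⁱ(P_k))` at the identity, which decreases in `i` because `ω - ω ∘ β = φ` is positive.
-/
theorem norm_omegaFun_iterate_le (hv : IsIsometricFamily v) (σ : A →ₚ[ℂ] ℂ) {k : ℕ}
    {B : bddSupp ι} (hB : (B : FockOp ι) ∈ supp ι k) (i : ℕ) :
    ‖omegaFun hv σ (betaB^[i] B)‖ ≤ (levelFun hv σ k 1).re * ‖(B : FockOp ι)‖ := by
  let P : bddSupp ι := ⟨compress k 1, mem_bddSupp_of_supp (compress_mem_supp k 1)⟩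
  have hP : (0 : FockOp ι) ≤ compress k 1 := compress_nonneg zero_le_one k
  have hdec : ∀ j, (omegaFun hv σ (betaB^[j] P)).re ≤ (levelFun hv σ k 1).re := by
    intro j
    induction j with
    | zero =>
      change (omegaFun hv σ P).re ≤ _
      rw [omegaFun_eq hv σ P (compress_mem_supp k 1)]
      change (levelFun hv σ k (compress k 1)).re ≤ _
      rw [levelFun_compress hv σ le_rfl]
    | succ j ih =>
      refine le_trans ?_ ih
      have h := omegaFun_sub_betaB hv σ (betaB^[j] P)
      have h2 : 0 ≤ defectFun hv σ (betaB^[j] P : bddSupp ι) := by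
        rw [coe_iterate_betaB]
        exact (defectFun hv σ).map_nonneg (iterate_beta_nonneg hP j)
      rw [← h] at h2
      have h3 := (Complex.nonneg_iff.1 h2).1
      rw [Complex.sub_re] at h3
      rw [Function.iterate_succ_apply']
      linarith
  let g : FockOp ι →ₚ[ℂ] ℂ := PositiveLinearMap.mk₀
    ((levelFun hv σ (k + i)).toLinearMap ∘ₗ iterBetaL ι i ∘ₗ compress k) fun T hT =>
      (levelFun hv σ (k + i)).map_nonneg (iterate_beta_nonneg (compress_nonneg hT k) i)
  have hg : ∀ T, g T = levelFun hv σ (k + i) ((beta ι)^[i] (compress k T)) := fun _ => rfl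
  have h1 := norm_apply_le_of_positive g B
  rw [hg, hg, compress_of_mem hB, ← omegaFun_iterate_eq hv σ hB le_rfl,
    ← omegaFun_iterate_eq hv σ (B := P) (compress_mem_supp k 1) le_rfl] at h1
  exact h1.trans (mul_le_mul_of_nonneg_right (hdec i) (norm_nonneg _))

/-- `P_N` is the sum of the `N + 1` projections `βⁱ(P_0)`, and `ω` is at most `ω(P_0)` on each.
Linear growth keeps the means by `N + 1` bounded. -/
theorem exists_levelFun_one_le (hv : IsIsometricFamily v) (σ : A →ₚ[ℂ] ℂ) :
    ∃ C, ∀ N : ℕ, (levelFun hv σ N 1).re ≤ (N + 1) * C := by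
  let P : bddSupp ι := ⟨proj ι 0, mem_bddSupp_of_supp (k := 0)
    (mem_supp_of (proj_mul_proj ι le_rfl) (proj_mul_proj ι le_rfl))⟩
  have hP : (P : FockOp ι) ∈ supp ι 0 :=
    mem_supp_of (proj_mul_proj ι le_rfl) (proj_mul_proj ι le_rfl)
  refine ⟨(levelFun hv σ 0 1).re, fun N => ?_⟩
  have hnn : 0 ≤ (levelFun hv σ 0 1).re :=
    (Complex.nonneg_iff.1 ((levelFun hv σ 0).map_nonneg zero_le_one)).1
  induction N with
  | zero => simp
  | succ N ih =>
    have e1 : compress (N + 1) (1 : FockOp ι) =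
        compress N 1 + (beta ι)^[N + 1] (proj ι 0) := by
      rw [compress_apply, compress_apply, mul_one, mul_one, proj_mul_proj ι le_rfl,
        proj_mul_proj ι le_rfl, iterate_beta_proj, proj, proj]
      simp
    have e2 : levelFun hv σ (N + 1) 1 =
        levelFun hv σ N 1 + omegaFun hv σ (betaB^[N + 1] P) := by
      rw [← levelFun_compress hv σ (le_refl (N + 1)), e1, map_add,
        levelFun_compress hv σ N.le_succ, omegaFun_iterate_eq hv σ hP (m := N + 1) (by omega)]
    have h1 := norm_omegaFun_iterate_le hv σ hP (N + 1)
    have h2 := (Complex.re_le_norm _).trans h1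
    have h3 : (levelFun hv σ 0 1).re * ‖(P : FockOp ι)‖ ≤ (levelFun hv σ 0 1).re * 1 := by
      gcongr
      exact norm_proj_le 0
    rw [e2, Complex.add_re]
    push_cast
    linarith

theorem tendsto_omegaFun_iterate (hv : IsIsometricFamily v) (σ : A →ₚ[ℂ] ℂ) (B : bddSupp ι)
    {T : FockOp ι} (h : IsLambda B T) :
    Tendsto (fun i => omegaFun hv σ (betaB^[i] B)) atTop
      (𝓝 (omegaFun hv σ B - defectFun hv σ T)) := by
  have h1 := h.tendsto (f := (defectFun hv σ).toLinearMap) (defectFun_normal hv σ)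
  have h2 := (tendsto_const_nhds (x := omegaFun hv σ B)).sub h1
  refine h2.congr fun n => ?_
  have : ∀ i, defectFun hv σ ((beta ι)^[i] B) =
      omegaFun hv σ (betaB^[i] B) - omegaFun hv σ (betaB^[i + 1] B) := fun i => by
    rw [Function.iterate_succ_apply', omegaFun_sub_betaB, coe_iterate_betaB]
  change omegaFun hv σ B - ∑ i ∈ Finset.range n, defectFun hv σ ((beta ι)^[i] B) = _
  simp only [this]
  rw [Finset.sum_range_sub' (fun i => omegaFun hv σ (betaB^[i] B))]
  simp

theorem levelFun_lambda (hv : IsIsometricFamily v) (σ : A →ₚ[ℂ] ℂ) {B T : FockOp ι}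
    (h : IsLambda B T) (N : ℕ) :
    levelFun hv σ N T = ∑ i ∈ Finset.range (N + 1), levelFun hv σ N ((beta ι)^[i] B) := by
  have h1 := h.tendsto (f := (levelFun hv σ N).toLinearMap) (levelFun_normal hv σ N)
  refine tendsto_nhds_unique h1 (tendsto_atTop_of_eventually_const (i₀ := N + 1) fun n hn => ?_)
  symm
  refine Finset.sum_subset (Finset.range_mono hn) fun i _ hi => ?_
  change levelFun hv σ N ((beta ι)^[i] B) = 0
  rw [← levelFun_compress hv σ le_rfl, compress_iterate_beta_eq_zero (by simpa using hi), map_zero]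

/-- For `i + k ≤ N` the operator `βⁱ(B)` already lies in `𝔅_N` and the terms cancel. At most `k`
indices remain, whatever `N` is, so the error disappears in the mean. -/
theorem norm_levelFun_lambda_sub_le (hv : IsIsometricFamily v) (σ : A →ₚ[ℂ] ℂ) {k : ℕ}
    {B : bddSupp ι} (hB : (B : FockOp ι) ∈ supp ι k) {T : FockOp ι} (h : IsLambda B T) (N : ℕ) :
    ‖levelFun hv σ N T - ∑ i ∈ Finset.range (N + 1), omegaFun hv σ (betaB^[i] B)‖ ≤
      k * (2 * ((levelFun hv σ k 1).re * ‖(B : FockOp ι)‖)) := by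
  set C := (levelFun hv σ k 1).re * ‖(B : FockOp ι)‖ with hC
  have hnn : 0 ≤ (levelFun hv σ k 1).re :=
    (Complex.nonneg_iff.1 ((levelFun hv σ k).map_nonneg zero_le_one)).1
  rw [levelFun_lambda hv σ h, ← Finset.sum_sub_distrib,
    ← Finset.sum_subset (s₁ := Finset.Ico (N + 1 - k) (N + 1))]
  · refine (norm_sum_le_of_le _ (f := fun i => _) (n := fun _ => 2 * C) fun i hi => ?_).trans ?_
    · rw [Finset.mem_Ico] at hi
      refine (norm_sub_le _ _).trans ?_
      have h1 : ‖levelFun hv σ N ((beta ι)^[i] B)‖ ≤ C := by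
        -- For the last indices `P_N βⁱ(B) P_N = βⁱ(P_{N-i} B P_{N-i})`, and `N - i ≤ k`, so the
        -- uniform bound applies to the compressed operator.
        let B' : bddSupp ι := ⟨compress (N - i) B, mem_bddSupp_of_supp (compress_mem_supp _ _)⟩
        have hB' : (B' : FockOp ι) ∈ supp ι (N - i) := compress_mem_supp _ _
        have e : levelFun hv σ N ((beta ι)^[i] B) = omegaFun hv σ (betaB^[i] B') := by
          rw [omegaFun_iterate_eq hv σ hB' (m := N) (by omega)]
          change _ = levelFun hv σ N ((beta ι)^[i] (compress (N - i) B))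
          rw [iterate_beta_compress, show i + (N - i) = N by omega, levelFun_compress hv σ le_rfl]
        rw [e]
        refine (norm_omegaFun_iterate_le hv σ (supp_mono (by omega) hB' : _ ∈ supp ι k) i).trans ?_
        rw [hC]
        gcongr
        exact norm_compress_le _ _
      have h2 := norm_omegaFun_iterate_le hv σ hB i
      linarith
    · rw [Finset.sum_const, nsmul_eq_mul, Nat.card_Ico]
      gcongr
      omega
  · intro i hi
    rw [Finset.mem_Ico] at hi
    exact Finset.mem_range.2 hi.2
  · intro i hi hi'
    rw [Finset.mem_range] at hi
    rw [Finset.mem_Ico] at hi'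
    rw [omegaFun_iterate_eq hv σ hB (m := N) (by omega), sub_self]

theorem tendsto_mean_levelFun (hv : IsIsometricFamily v) (σ : A →ₚ[ℂ] ℂ) (B : bddSupp ι)
    {T : FockOp ι} (h : IsLambda B T) :
    Tendsto (fun N : ℕ => ((N + 1 : ℝ)⁻¹) • levelFun hv σ N T) atTop
      (𝓝 (omegaFun hv σ B - defectFun hv σ T)) := by
  obtain ⟨k, hk⟩ := mem_bddSupp.1 B.2
  have h1 := (tendsto_omegaFun_iterate hv σ B h).cesaro_smul
  have h2 := (tendsto_add_atTop_iff_nat 1).2 h1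
  set K := k * (2 * ((levelFun hv σ k 1).re * ‖(B : FockOp ι)‖))
  have h3 : Tendsto (fun N : ℕ => ((N + 1 : ℝ)⁻¹) • (levelFun hv σ N T -
      ∑ i ∈ Finset.range (N + 1), omegaFun hv σ (betaB^[i] B))) atTop (𝓝 0) := by
    refine squeeze_zero_norm (a := fun N : ℕ => (1 / ((N : ℝ) + 1)) * K) (fun N => ?_) ?_
    · rw [norm_smul, Real.norm_of_nonneg (by positivity), one_div]
      gcongr
      exact norm_levelFun_lambda_sub_le hv σ hk h N
    · have := tendsto_one_div_add_atTop_nhds_zero_nat (𝕜 := ℝ).mul_const K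
      simpa using this
  have h4 := h3.add h2
  rw [zero_add] at h4
  refine h4.congr fun N => ?_
  push_cast
  rw [smul_sub, sub_add_cancel]

theorem exists_essentialFun (hv : IsIsometricFamily v) (σ : A →ₚ[ℂ] ℂ) :
    ∃ D : FockOp ι →ₚ[ℂ] ℂ, ∀ (B : bddSupp ι) (T : FockOp ι), IsLambda B T →
      D T = omegaFun hv σ B - defectFun hv σ T := by
  obtain ⟨C, hC⟩ := exists_levelFun_one_le hv σ
  obtain ⟨D, hD⟩ := exists_positive_limit (fun N => levelFun hv σ N)
    (fun N => ((N : ℝ) + 1)⁻¹) (fun N => by positivity) C fun N => by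
      rw [inv_mul_le_iff₀ (by positivity)]
      exact hC N
  exact ⟨D, fun B T h => hD T _ (tendsto_mean_levelFun hv σ B h)⟩

/-- A positive functional with `D(λ(B)) = ω(B) - φ(λ(B))`, where `φ` is the normal part. -/
noncomputable def essentialFun (hv : IsIsometricFamily v) (σ : A →ₚ[ℂ] ℂ) : FockOp ι →ₚ[ℂ] ℂ :=
  (exists_essentialFun hv σ).choose

theorem essentialFun_lambda (hv : IsIsometricFamily v) (σ : A →ₚ[ℂ] ℂ) (B : bddSupp ι)
    {T : FockOp ι} (h : IsLambda B T) :
    essentialFun hv σ T = omegaFun hv σ B - defectFun hv σ T :=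
  (exists_essentialFun hv σ).choose_spec B T h

end functional

/-! ### Density of the words -/

section density

variable {ι : Type u} {A : Type v} [CStarAlgebra A] {v : ι → A}

/-- The elements `x` for which both `x` and `x*` multiply `N` into itself form a `*`-algebra
containing the generators; apply them to `1` and take closures. -/
theorem mem_of_invariant (hv : IsToeplitzCuntz v) (N : Submodule ℂ A) (hN : IsClosed (N : Set A))
    (h1 : 1 ∈ N) (hl : ∀ i, ∀ a ∈ N, v i * a ∈ N) (hr : ∀ i, ∀ a ∈ N, star (v i) * a ∈ N) (a : A) :
    a ∈ N := by
  have key : ∀ x ∈ StarAlgebra.adjoin ℂ (Set.range v),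
      (∀ a ∈ N, x * a ∈ N) ∧ ∀ a ∈ N, star x * a ∈ N := by
    intro x hx
    induction hx using StarAlgebra.adjoin_induction with
    | mem x hx =>
      obtain ⟨i, rfl⟩ := hx
      exact ⟨hl i, hr i⟩
    | algebraMap r =>
      refine ⟨fun a ha => ?_, fun a ha => ?_⟩
      · rw [← Algebra.smul_def]
        exact N.smul_mem r ha
      · rw [← algebraMap_star_comm, ← Algebra.smul_def]
        exact N.smul_mem _ ha
    | add x y _ _ hx hy =>
      refine ⟨fun a ha => ?_, fun a ha => ?_⟩
      · rw [add_mul]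
        exact N.add_mem (hx.1 a ha) (hy.1 a ha)
      · rw [star_add, add_mul]
        exact N.add_mem (hx.2 a ha) (hy.2 a ha)
    | mul x y _ _ hx hy =>
      refine ⟨fun a ha => ?_, fun a ha => ?_⟩
      · rw [mul_assoc]
        exact hx.1 _ (hy.1 a ha)
      · rw [star_mul, mul_assoc]
        exact hy.2 _ (hx.2 a ha)
    | star x _ hx => exact ⟨hx.2, by simpa using hx.1⟩
  have ha : a ∈ (StarAlgebra.adjoin ℂ (Set.range v)).topologicalClosure := by
    rw [hv.generates]
    trivial
  rw [← SetLike.mem_coe, StarSubalgebra.topologicalClosure_coe] at ha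
  refine closure_minimal (fun x hx => ?_) hN ha
  simpa using (key x hx).1 1 h1

theorem star_mul_word (hv : IsIsometricFamily v) (i : ι) (α β : List ι) :
    ∃ (c : ℂ) (γ δ : List ι), star (v i) * (word v α * star (word v β)) =
      c • (word v γ * star (word v δ)) := by
  rcases α with _ | ⟨j, α⟩
  · refine ⟨1, [], β ++ [i], ?_⟩
    rw [word_nil, one_mul, one_mul, one_smul, word_append, word_singleton, star_mul]
  · by_cases h : i = j
    · subst h
      refine ⟨1, α, β, ?_⟩
      rw [word_cons, one_smul, ← mul_assoc, ← mul_assoc, hv.1, one_mul]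
    · refine ⟨0, [], [], ?_⟩
      rw [word_cons, zero_smul, ← mul_assoc, ← mul_assoc, hv.2 i j h, zero_mul, zero_mul]

/-- Left multiplication by `vᵢ` or `vᵢ*` sends `v_α v_β*` to a monomial of the same form or to zero,
so the closed span of these monomials is everything. -/
theorem mem_of_words (hv : IsToeplitzCuntz v) (N : Submodule ℂ A) (hN : IsClosed (N : Set A))
    (h : ∀ α β, word v α * star (word v β) ∈ N) (a : A) : a ∈ N := by
  set S : Submodule ℂ A :=
    Submodule.span ℂ (Set.range fun p : List ι × List ι => word v p.1 * star (word v p.2))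
  have hS : S ≤ N := Submodule.span_le.2 (by rintro _ ⟨p, rfl⟩; exact h _ _)
  refine S.topologicalClosure_minimal hS hN (mem_of_invariant hv S.topologicalClosure
    S.isClosed_topologicalClosure (S.le_topologicalClosure (Submodule.subset_span
      ⟨([], []), by simp [word_nil]⟩)) (fun i a ha => ?_) (fun i a ha => ?_) a)
  · refine map_mem_closure (continuous_const_mul (v i)) ha fun x hx => ?_
    have : S ≤ S.comap (LinearMap.mulLeft ℂ (v i)) := by
      refine Submodule.span_le.2 ?_
      rintro _ ⟨p, rfl⟩
      refine Submodule.subset_span ⟨(i :: p.1, p.2), ?_⟩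
      simp [word_cons, mul_assoc]
    exact this hx
  · refine map_mem_closure (continuous_const_mul (star (v i))) ha fun x hx => ?_
    have : S ≤ S.comap (LinearMap.mulLeft ℂ (star (v i))) := by
      refine Submodule.span_le.2 ?_
      rintro _ ⟨p, rfl⟩
      obtain ⟨c, γ, δ, e⟩ := star_mul_word hv.isometricFamily i p.1 p.2
      change star (v i) * (word v p.1 * star (word v p.2)) ∈ S
      rw [e]
      exact S.smul_mem c (Submodule.subset_span ⟨(γ, δ), rfl⟩)
    exact this hx

variable [PartialOrder A] [StarOrderedRing A]

theorem positive_ext_words (hv : IsToeplitzCuntz v) {σ τ : A →ₚ[ℂ] ℂ}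
    (h : ∀ α β, σ (word v α * star (word v β)) = τ (word v α * star (word v β))) : σ = τ := by
  refine PositiveLinearMap.ext fun a => ?_
  exact mem_of_words hv (LinearMap.eqLocus σ.toLinearMap τ.toLinearMap)
    (isClosed_eq (continuous_of_positive σ) (continuous_of_positive τ)) h a

theorem mem_of_invariant_gns (hv : IsToeplitzCuntz v) (σ : A →ₚ[ℂ] ℂ) (K : Submodule ℂ σ.GNS)
    (hK : IsClosed (K : Set σ.GNS)) (h1 : cyclicWord v σ [] ∈ K)
    (hl : ∀ i, ∀ x ∈ K, σ.gnsStarAlgHom (v i) x ∈ K)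
    (hr : ∀ i, ∀ x ∈ K, σ.gnsStarAlgHom (star (v i)) x ∈ K) (x : σ.GNS) : x ∈ K := by
  let g : A →ₗ[ℂ] σ.GNS :=
    { toFun := gnsVec σ
      map_add' := fun a b => by simp [gnsVec, UniformSpace.Completion.coe_add]
      map_smul' := fun c a => by simp [gnsVec] }
  have hg : ∀ a, gnsVec σ a ∈ K := by
    intro a
    refine mem_of_invariant hv (K.comap g) (hK.preimage (continuous_gnsVec σ)) ?_
      (fun i a ha => ?_) (fun i a ha => ?_) a
    · simp only [cyclicWord, word_nil, star_one] at h1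
      exact h1
    · change gnsVec σ (v i * a) ∈ K
      rw [← gnsStarAlgHom_gnsVec]
      exact hl i _ ha
    · change gnsVec σ (star (v i) * a) ∈ K
      rw [← gnsStarAlgHom_gnsVec]
      exact hr i _ ha
  exact (denseRange_gnsVec σ).induction_on x hK hg

end density

/-! ### Essential and singular functionals -/

section criteria

variable {ι : Type u} {A : Type v} [CStarAlgebra A] [PartialOrder A] [StarOrderedRing A]
  {v : ι → A}

theorem rangeProj_one_apply (hv : IsIsometricFamily v) (σ : A →ₚ[ℂ] ℂ) (x : σ.GNS) :
    HasSum (fun i => σ.gnsStarAlgHom (v i * star (v i)) x) (rangeProj hv σ 1 x) := by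
  refine (hasSum_gnsEndo hv σ 1 x).congr_fun fun i => ?_
  rw [map_mul]
  rfl

theorem rangeProj_eq_one (hv : IsIsometricFamily v) {σ : A →ₚ[ℂ] ℂ} (h : IsEssential v σ) (k : ℕ) :
    rangeProj hv σ k = 1 := by
  have h1 : rangeProj hv σ 1 = 1 := by
    ext1 x
    exact (rangeProj_one_apply hv σ x).unique (h x)
  induction k with
  | zero => rfl
  | succ k ih => rw [rangeProj_succ, ih]; exact h1

theorem moment_of_isEssential (hv : IsIsometricFamily v) {σ : A →ₚ[ℂ] ℂ} (h : IsEssential v σ)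
    (k : ℕ) (α β : List ι) : moment hv σ k α β = σ (word v α * star (word v β)) := by
  rw [← moment_zero hv, moment, moment, rangeProj_eq_one hv h, rangeProj_zero]

theorem tendsto_moment_of_isSingular (hv : IsIsometricFamily v) {σ : A →ₚ[ℂ] ℂ}
    (h : IsSingular v σ) (α β : List ι) :
    Tendsto (fun k => moment hv σ k α β) atTop (𝓝 0) := by
  obtain ⟨s, hs, hs0⟩ := h (cyclicWord v σ β)
  have e : ∀ k, rangeProj hv σ k (cyclicWord v σ β) = s k := fun k =>
    (hasSum_rangeProj hv σ k _).unique (hs k)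
  have := ((innerSL ℂ (cyclicWord v σ α)).continuous.tendsto 0).comp hs0
  rw [map_zero] at this
  refine this.congr fun k => ?_
  rw [moment, e]
  rfl

theorem norm_sub_rangeProj_sq (hv : IsIsometricFamily v) (σ : A →ₚ[ℂ] ℂ) (k : ℕ) (x : σ.GNS) :
    ‖x - rangeProj hv σ k x‖ ^ 2 = ‖x‖ ^ 2 - ‖rangeProj hv σ k x‖ ^ 2 := by
  rw [@norm_sub_sq ℂ, ← inner_rangeProj, inner_self_eq_norm_sq]
  ring

theorem isEssential_of_moment (hv : IsToeplitzCuntz v) {σ : A →ₚ[ℂ] ℂ}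
    (h : ∀ k, moment hv.isometricFamily σ k [] [] = moment hv.isometricFamily σ 0 [] []) :
    IsEssential v σ := by
  set hw := hv.isometricFamily
  -- All `k` are imposed at once because invariance under `π(vᵢ)*` uses the next level: `Q_k π(vᵢ)*
  -- = π(vᵢ)* Q_{k+1}`. The hypothesis puts `ξ` in `K`, as `‖ξ - Q_k ξ‖² = m_0 - m_k`, and cyclicity
  -- does the rest.
  let K : Submodule ℂ σ.GNS :=
    ⨅ k, LinearMap.eqLocus (rangeProj hw σ k).toLinearMap (LinearMap.id : σ.GNS →ₗ[ℂ] σ.GNS)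
  have hmem : ∀ x, x ∈ K ↔ ∀ k, rangeProj hw σ k x = x := fun x => by
    simp [K, Submodule.mem_iInf, LinearMap.mem_eqLocus]
  have hK : IsClosed (K : Set σ.GNS) := by
    have : (K : Set σ.GNS) = ⋂ k, {x | rangeProj hw σ k x = x} := by
      ext x
      simp [hmem]
    rw [this]
    exact isClosed_iInter fun k => isClosed_eq (rangeProj hw σ k).continuous continuous_id
  have key : ∀ x, x ∈ K := by
    refine mem_of_invariant_gns hv σ K hK ((hmem _).2 fun k => ?_) (fun i x hx => ?_)
      (fun i x hx => ?_)
    · have e := h k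
      rw [norm_sq_rangeProj, norm_sq_rangeProj, rangeProj_zero] at e
      have e2 := norm_sub_rangeProj_sq hw σ k (cyclicWord v σ [])
      rw [Complex.ofReal_injective e] at e2
      simp only [one_apply_eq_self, sub_self] at e2
      exact (sub_eq_zero.1 (norm_eq_zero.1 (pow_eq_zero_iff (two_ne_zero)|>.1 e2))).symm
    · rw [hmem] at hx ⊢
      intro k
      rcases k with _ | k
      · rfl
      · rw [rangeProj_succ, gnsEndo_gen, hx]
    · rw [hmem] at hx ⊢
      intro k
      rw [← star_gnsEndo hw, ← rangeProj_succ, hx]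
  intro x
  have := rangeProj_one_apply hw σ x
  rwa [(hmem x).1 (key x) 1] at this

theorem isSingular_of_moment (hv : IsToeplitzCuntz v) {σ : A →ₚ[ℂ] ℂ}
    (h : Tendsto (fun k => moment hv.isometricFamily σ k [] []) atTop (𝓝 0)) :
    IsSingular v σ := by
  set hw := hv.isometricFamily
  -- The vectors with `Q_k x → 0` form a closed subspace since the `Q_k` are contractions, and it is
  -- invariant since `π(vᵢ)` and `π(vᵢ)*` only shift `k`. It contains `ξ` because `‖Q_k ξ‖²` is the
  -- moment at the empty words.
  let K : Submodule ℂ σ.GNS :=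
    { carrier := {x | Tendsto (fun k => rangeProj hw σ k x) atTop (𝓝 0)}
      add_mem' := fun {x y} hx hy => by
        have h : Tendsto (fun k => rangeProj hw σ k x + rangeProj hw σ k y) atTop (𝓝 (0 + 0)) :=
          Tendsto.add hx hy
        rw [add_zero] at h
        exact h.congr fun k => (map_add _ x y).symm
      zero_mem' := by simp
      smul_mem' := fun c x hx => by
        have h : Tendsto (fun k => c • rangeProj hw σ k x) atTop (𝓝 (c • 0)) :=
          Tendsto.const_smul hx c
        rw [smul_zero] at h
        exact h.congr fun k => (map_smul _ c x).symm }
  have hmem : ∀ x, x ∈ K ↔ Tendsto (fun k => rangeProj hw σ k x) atTop (𝓝 0) := fun x => Iff.rfl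
  have hK : IsClosed (K : Set σ.GNS) := by
    refine isClosed_of_closure_subset fun x hx => ?_
    rw [SetLike.mem_coe, hmem, Metric.tendsto_atTop]
    intro ε hε
    obtain ⟨y, hy, hxy⟩ := Metric.mem_closure_iff.1 hx (ε / 2) (by positivity)
    obtain ⟨n, hn⟩ := Metric.tendsto_atTop.1 ((hmem y).1 hy) (ε / 2) (by positivity)
    refine ⟨n, fun k hk => ?_⟩
    have h1 := hn k hk
    rw [dist_zero_right] at h1 ⊢
    rw [dist_eq_norm] at hxy
    have h2 := norm_rangeProj_apply_le hw σ k (x - y)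
    rw [map_sub] at h2
    have h3 := norm_add_le (rangeProj hw σ k x - rangeProj hw σ k y) (rangeProj hw σ k y)
    rw [sub_add_cancel] at h3
    linarith
  have key : ∀ x, x ∈ K := by
    refine mem_of_invariant_gns hv σ K hK ((hmem _).2 ?_) (fun i x hx => ?_) (fun i x hx => ?_)
    · have h1 := h.norm.sqrt
      rw [norm_zero, Real.sqrt_zero] at h1
      refine tendsto_zero_iff_norm_tendsto_zero.2 (h1.congr fun k => ?_)
      rw [norm_sq_rangeProj, Complex.norm_real, Real.norm_of_nonneg (by positivity),
        Real.sqrt_sq (norm_nonneg _)]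
    · rw [hmem] at hx ⊢
      rw [← tendsto_add_atTop_iff_nat 1]
      have := ((σ.gnsStarAlgHom (v i)).continuous.tendsto 0).comp hx
      rw [map_zero] at this
      refine this.congr fun k => ?_
      rw [rangeProj_succ, gnsEndo_gen]
      rfl
    · rw [hmem] at hx ⊢
      rw [← tendsto_add_atTop_iff_nat 1] at hx
      have := ((σ.gnsStarAlgHom (star (v i))).continuous.tendsto 0).comp hx
      rw [map_zero] at this
      refine this.congr fun k => ?_
      rw [← star_gnsEndo hw, ← rangeProj_succ]
      rfl
  exact fun x => ⟨fun k => rangeProj hw σ k x, fun k => hasSum_rangeProj hw σ k x,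
    (hmem x).1 (key x)⟩

end criteria

/-! ### Representing functionals -/

section representation

variable {ι : Type u} {A : Type v} [CStarAlgebra A] [PartialOrder A] [StarOrderedRing A]
  {v : ι → A}

/-- The matrix unit as an element of `𝔅`. -/
noncomputable def unitB (α β : List ι) : bddSupp ι := ⟨matrixUnit α β, matrixUnit_mem_bddSupp α β⟩

theorem compFockRep_apply (hv : IsToeplitzCuntz v) (φ : FockOp ι →ₚ[ℂ] ℂ) (a : A) :
    compFockRep hv φ a = φ (fockRep hv a) := rfl

theorem essentialFun_fockRep (hv : IsToeplitzCuntz v) (ρ : A →ₚ[ℂ] ℂ) (α β : List ι) :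
    essentialFun hv.isometricFamily ρ (fockRep hv (word v α * star (word v β))) =
      ρ (word v α * star (word v β)) -
        defectFun hv.isometricFamily ρ (fockRep hv (word v α * star (word v β))) := by
  rw [essentialFun_lambda hv.isometricFamily ρ (unitB α β) (isLambda_matrixUnit hv α β), unitB,
    omegaFun_matrixUnit]

theorem eq_defect_add_essential (hv : IsToeplitzCuntz v) (ρ : A →ₚ[ℂ] ℂ) :
    ρ = compFockRep hv (defectFun hv.isometricFamily ρ) +
      compFockRep hv (essentialFun hv.isometricFamily ρ) := by
  refine positive_ext_words hv fun α β => ?_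
  rw [PositiveLinearMap.add_apply, compFockRep_apply, compFockRep_apply, essentialFun_fockRep,
    add_sub_cancel]

theorem fockRep_mem_closure (hv : IsToeplitzCuntz v) (a : A) :
    fockRep hv a ∈ (lambdaB ι).topologicalClosure :=
  mem_of_words hv ((lambdaB ι).topologicalClosure.comap (fockRep hv).toLinearMap)
    ((lambdaB ι).isClosed_topologicalClosure.preimage (map_continuous (fockRep hv)))
    (fun α β => (lambdaB ι).le_topologicalClosure
      ⟨_, matrixUnit_mem_bddSupp α β, isLambda_matrixUnit hv α β⟩) a

theorem represents_omegaFun (hv : IsToeplitzCuntz v) (ρ : A →ₚ[ℂ] ℂ) :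
    Represents hv (omegaFun hv.isometricFamily ρ) ρ where
  pos := isPos_omegaFun _ ρ
  decreasing := isDecreasing_omegaFun _ ρ
  locallyNormal := isLocallyNormal_omegaFun _ ρ
  eq_delta_comp := by
    set hw := hv.isometricFamily
    -- `Δω` is taken as the restriction of `φ + D`, which is positive on all bounded operators and
    -- equals `ω(B)` at `λ(B)`.
    refine ⟨(defectFun hw ρ + essentialFun hw ρ).toLinearMap ∘ₗ
      (lambdaB ι).topologicalClosure.subtype, ⟨fun T hT => ?_, fun T hT => ?_⟩, fun a =>
        ⟨fockRep_mem_closure hv a, ?_⟩⟩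
    · exact (defectFun hw ρ + essentialFun hw ρ).map_nonneg hT
    · obtain ⟨B, hB, h⟩ := hT
      have e := h.delta_eq
      have hm : delta T ∈ bddSupp ι := e ▸ hB
      refine ⟨hm, ?_⟩
      change defectFun hw ρ T + essentialFun hw ρ T = _
      rw [essentialFun_lambda hw ρ ⟨delta T, hm⟩ (e.symm ▸ h), add_sub_cancel]
    · exact DFunLike.congr_fun (eq_defect_add_essential hv ρ) a

end representation

section uniqueness

variable {ι : Type u} {A : Type v} [CStarAlgebra A] [PartialOrder A] {v : ι → A}

/-- Evaluate `ρ = Δω ∘ l` at `v_α v_β*`: there `l(v_α v_β*) = λ(e_α e_β*)`, and `δ` returns the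
matrix unit. -/
theorem Represents.matrixUnit {hv : IsToeplitzCuntz v} {ω : bddSupp ι →ₗ[ℂ] ℂ} {ρ : A →ₚ[ℂ] ℂ}
    (h : Represents hv ω ρ) (α β : List ι) :
    ω (unitB α β) = ρ (word v α * star (word v β)) := by
  obtain ⟨D, hD, hρ⟩ := h.eq_delta_comp
  obtain ⟨_, e1⟩ := hρ (word v α * star (word v β))
  have hl := isLambda_matrixUnit hv α β
  obtain ⟨hm, e2⟩ := hD.extends_delta _ ⟨_, matrixUnit_mem_bddSupp α β, hl⟩
  rw [e1, e2]
  congr 1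
  exact Subtype.ext hl.delta_eq.symm

/-- Compression to `P_k` as a map into `𝔅`. -/
noncomputable def compressB (k : ℕ) : FockOp ι →ₗ[ℂ] bddSupp ι where
  toFun T := ⟨compress k T, mem_bddSupp_of_supp (compress_mem_supp k T)⟩
  map_add' S T := Subtype.ext (map_add _ S T)
  map_smul' c T := Subtype.ext (map_smul _ c T)

theorem IsLocallyNormal.tendsto_coordProj {ω : bddSupp ι →ₗ[ℂ] ℂ} (h : IsLocallyNormal ω) (k : ℕ)
    (T : FockOp ι) :
    Tendsto (fun s => (ω ∘ₗ compressB k) (coordProj s * T * coordProj s)) atTop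
      (𝓝 ((ω ∘ₗ compressB k) T)) :=
  (h k).tendsto (F := fun s => ⟨compress k (coordProj s * T * coordProj s), compress_mem_supp k _⟩)
    (T := ⟨compress k T, compress_mem_supp k T⟩) ((bStrong_coordProj T).mul_mul _ _)

/-- A locally normal functional on `𝔅` is determined by the matrix units. -/
theorem IsLocallyNormal.ext {ω ω' : bddSupp ι →ₗ[ℂ] ℂ} (h : IsLocallyNormal ω)
    (h' : IsLocallyNormal ω') (he : ∀ α β, ω (unitB α β) = ω' (unitB α β)) : ω = ω' := by
  refine LinearMap.ext fun B => ?_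
  obtain ⟨k, hk⟩ := mem_bddSupp.1 B.2
  have key : ω ∘ₗ compressB k = ω' ∘ₗ compressB k := by
    refine eq_of_matrixUnit (h.tendsto_coordProj k) (h'.tendsto_coordProj k) fun α β => ?_
    have e : compressB k (matrixUnit α β) =
        if α.length ≤ k ∧ β.length ≤ k then unitB α β else 0 := by
      refine Subtype.ext ((compress_matrixUnit k α β).trans ?_)
      split_ifs <;> rfl
    rw [LinearMap.comp_apply, LinearMap.comp_apply, e]
    split_ifs
    · exact he α β
    · rw [map_zero, map_zero]
  have e : compressB k (B : FockOp ι) = B := Subtype.ext (compress_of_mem hk)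
  have := LinearMap.congr_fun key B
  rwa [LinearMap.comp_apply, LinearMap.comp_apply, e] at this

theorem Represents.unique {hv : IsToeplitzCuntz v} {ω ω' : bddSupp ι →ₗ[ℂ] ℂ} {ρ : A →ₚ[ℂ] ℂ}
    (h : Represents hv ω ρ) (h' : Represents hv ω' ρ) : ω = ω' :=
  h.locallyNormal.ext h'.locallyNormal fun α β => by rw [h.matrixUnit, h'.matrixUnit]

theorem IsNormalExtension.unique {ω : bddSupp ι →ₗ[ℂ] ℂ} {φ φ' : FockOp ι →ₚ[ℂ] ℂ}
    (h : IsNormalExtension ω φ) (h' : IsNormalExtension ω φ') : φ = φ' := by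
  refine PositiveLinearMap.toLinearMap_injective (eq_of_matrixUnit
    (fun T => h.normal.tendsto_univ (bStrong_coordProj T))
    (fun T => h'.normal.tendsto_univ (bStrong_coordProj T)) fun α β => ?_)
  exact (h.extends_delta (unitB α β)).trans (h'.extends_delta (unitB α β)).symm

end uniqueness

/-! ### The decomposition -/

section decomposition

variable {ι : Type u} {A : Type v} [CStarAlgebra A] [PartialOrder A] [StarOrderedRing A]
  {v : ι → A}

/-- Both sides obey the same recursion, summing over a letter appended to both words. Normality at
the single level `m`, large enough for all the words involved, lets `ω` pass through the sum. -/
theorem omegaFun_iterate_unitB (hv : IsIsometricFamily v) (σ : A →ₚ[ℂ] ℂ) (i : ℕ)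
    (α β : List ι) : omegaFun hv σ (betaB^[i] (unitB α β)) = moment hv σ i α β := by
  induction i generalizing α β with
  | zero =>
    rw [moment_zero]
    exact omegaFun_matrixUnit hv σ α β
  | succ i ih =>
    have hm : ∀ α β : List ι, (unitB α β : FockOp ι) ∈ supp ι (max α.length β.length) :=
      fun α β => matrixUnit_mem_supp (le_max_left _ _) (le_max_right _ _)
    set m := max α.length β.length + (i + 1) with hm'
    have hs := (levelFun_normal hv σ m).hasSum_beta (f := (levelFun hv σ m).toLinearMap) i α β
    rw [omegaFun_iterate_eq hv σ (hm α β) (m := m) le_rfl, Function.iterate_succ_apply]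
    refine hs.unique ((hasSum_moment hv σ i α β).congr_fun fun j => ?_)
    rw [← ih, omegaFun_iterate_eq hv σ (hm (α ++ [j]) (β ++ [j])) (m := m) (by
      simp only [List.length_append, List.length_singleton]
      omega)]
    rfl

theorem tendsto_moment (hv : IsToeplitzCuntz v) (ρ : A →ₚ[ℂ] ℂ) (α β : List ι) :
    Tendsto (fun i => moment hv.isometricFamily ρ i α β) atTop
      (𝓝 (compFockRep hv (essentialFun hv.isometricFamily ρ) (word v α * star (word v β)))) := by
  rw [compFockRep_apply, essentialFun_lambda hv.isometricFamily ρ (unitB α β)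
    (isLambda_matrixUnit hv α β)]
  simp only [← omegaFun_iterate_unitB]
  exact tendsto_omegaFun_iterate hv.isometricFamily ρ (unitB α β) (isLambda_matrixUnit hv α β)

theorem norm_moment_le (hv : IsIsometricFamily v) (σ : A →ₚ[ℂ] ℂ) (k : ℕ) (α : List ι) :
    ‖moment hv σ k α α‖ ≤ ‖cyclicWord v σ α‖ ^ 2 := by
  rw [norm_sq_rangeProj, Complex.norm_real, Real.norm_of_nonneg (by positivity)]
  gcongr
  exact norm_rangeProj_apply_le hv σ k _

/-- Let `k → ∞` in `∑ⱼ m_k(αj, αj) = m_{k+1}(α, α)`; the terms are dominated by `‖h_{αj}‖²`, which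
is summable over `j`. -/
theorem hasSum_essential (hv : IsToeplitzCuntz v) (ρ : A →ₚ[ℂ] ℂ) (α : List ι) :
    HasSum (fun j => compFockRep hv (essentialFun hv.isometricFamily ρ)
        (word v (α ++ [j]) * star (word v (α ++ [j]))))
      (compFockRep hv (essentialFun hv.isometricFamily ρ) (word v α * star (word v α))) := by
  set hw := hv.isometricFamily
  have hsum := (hasSum_norm_sq_cyclicWord hw ρ α).summable
  have h1 := tendsto_tsum_of_dominated_convergence hsum
    (fun j => tendsto_moment hv ρ (α ++ [j]) (α ++ [j]))
    (Eventually.of_forall fun k j => norm_moment_le hw ρ k (α ++ [j]))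
  simp only [(hasSum_moment hw ρ _ α α).tsum_eq] at h1
  have h2 := tendsto_nhds_unique h1 ((tendsto_add_atTop_iff_nat 1).2 (tendsto_moment hv ρ α α))
  rw [← h2]
  refine (Summable.of_norm_bounded hsum fun j => ?_).hasSum
  exact le_of_tendsto' (tendsto_moment hv ρ (α ++ [j]) (α ++ [j])).norm
    fun k => norm_moment_le hw ρ k (α ++ [j])

theorem moment_essential (hv : IsToeplitzCuntz v) (ρ : A →ₚ[ℂ] ℂ) (k : ℕ) (α : List ι) :
    moment hv.isometricFamily (compFockRep hv (essentialFun hv.isometricFamily ρ)) k α α =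
      compFockRep hv (essentialFun hv.isometricFamily ρ) (word v α * star (word v α)) := by
  induction k generalizing α with
  | zero => exact moment_zero _ _ _ _
  | succ k ih =>
    refine (hasSum_moment hv.isometricFamily _ k α α).unique ?_
    simp only [ih]
    exact hasSum_essential hv ρ α

theorem isDecomposition_defect_essential (hv : IsToeplitzCuntz v) (ρ : A →ₚ[ℂ] ℂ) :
    IsDecomposition v ρ (compFockRep hv (defectFun hv.isometricFamily ρ))
      (compFockRep hv (essentialFun hv.isometricFamily ρ)) where
  singular := by
    refine isSingular_of_moment hv ?_
    have h := (tendsto_moment hv ρ [] []).sub_const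
      (compFockRep hv (essentialFun hv.isometricFamily ρ) (word v [] * star (word v [])))
    rw [sub_self] at h
    refine h.congr fun k => ?_
    -- The moments of the essential summand do not depend on `k` and equal the limit of those of
    -- `ρ`, so additivity leaves moments tending to zero for the other summand.
    have e := moment_add hv.isometricFamily (compFockRep hv (defectFun hv.isometricFamily ρ))
      (compFockRep hv (essentialFun hv.isometricFamily ρ)) k [] []
    rw [← eq_defect_add_essential, moment_essential] at e
    rw [e, add_sub_cancel_right]
  essential := isEssential_of_moment hv fun k => by rw [moment_essential, moment_essential]
  eq_add := eq_defect_add_essential hv ρ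

theorem IsDecomposition.tendsto_moment (hv : IsIsometricFamily v) {ρ σ τ : A →ₚ[ℂ] ℂ}
    (h : IsDecomposition v ρ σ τ) (α β : List ι) :
    Tendsto (fun k => moment hv ρ k α β) atTop (𝓝 (τ (word v α * star (word v β)))) := by
  have h1 := (tendsto_moment_of_isSingular hv h.singular α β).add_const
    (τ (word v α * star (word v β)))
  rw [zero_add] at h1
  refine h1.congr fun k => ?_
  rw [h.eq_add, moment_add, moment_of_isEssential hv h.essential]

theorem IsDecomposition.unique (hv : IsToeplitzCuntz v) {ρ σ τ σ' τ' : A →ₚ[ℂ] ℂ}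
    (h : IsDecomposition v ρ σ τ) (h' : IsDecomposition v ρ σ' τ') : σ' = σ ∧ τ' = τ := by
  have hτ : τ' = τ := positive_ext_words hv fun α β =>
    tendsto_nhds_unique (h'.tendsto_moment hv.isometricFamily α β)
      (h.tendsto_moment hv.isometricFamily α β)
  refine ⟨PositiveLinearMap.ext fun a => ?_, hτ⟩
  have e := DFunLike.congr_fun (h'.eq_add.symm.trans h.eq_add) a
  rw [hτ, PositiveLinearMap.add_apply, PositiveLinearMap.add_apply] at e
  exact add_right_cancel e

end decomposition

end TC

theorem mainTheorem4 {ι : Type u} [Countable ι] [Nonempty ι]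
    {A : Type v} [CStarAlgebra A] [PartialOrder A] [StarOrderedRing A]
    {v : ι → A} (hv : TC.IsToeplitzCuntz v) (ρ : A →ₚ[ℂ] ℂ) :
    (∃! ω : TC.bddSupp ι →ₗ[ℂ] ℂ, TC.Represents hv ω ρ) ∧
    ∀ ω : TC.bddSupp ι →ₗ[ℂ] ℂ, TC.Represents hv ω ρ →
      ∃ φ : TC.FockOp ι →ₚ[ℂ] ℂ, TC.IsNormalExtension ω φ ∧
        (∀ φ' : TC.FockOp ι →ₚ[ℂ] ℂ, TC.IsNormalExtension ω φ' → φ' = φ) ∧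
        TC.IsSingularPart v ρ (TC.compFockRep hv φ) := by
  have hrep := TC.represents_omegaFun hv ρ
  refine ⟨⟨_, hrep, fun ω h => h.unique hrep⟩, fun ω h => ?_⟩
  obtain rfl := h.unique hrep
  have hφ := TC.isNormalExtension_defectFun hv.isometricFamily ρ
  have hd := TC.isDecomposition_defect_essential hv ρ
  exact ⟨_, hφ, fun φ' h' => h'.unique hφ, _, hd, fun σ' τ' h' => hd.unique hv h'⟩
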